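/- Let $T>0$, $p,b\in[0,1]$ with $p+b\neq 1$, $\alpha_1,\alpha_2\in(0,1)$, $B_{\alpha_1}^{-1},B_{\alpha_2}^{-1}>0$, $U(1),U(2)\in\mathbb R$, $\rho\in\mathbb C$, and $G_{1,0},G_{2,0}\in\mathbb C$. Let $G_1,G_2:(0,T]\to\mathbb C$ be a solution of the Feynman–Kac system with two internal states $$ \begin{aligned} p\left(\tfrac{\partial}{\partial t}+U(1)\rho\right)G_{1}+(1-b)\left(\tfrac{\partial}{\partial t}+U(2)\rho\right)G_{2} &=(p-1)B_{\alpha_{1}}^{-1}\mathfrak{D}_{t}^{1-\alpha_{1}}G_{1}+(1-b)B_{\alpha_{2}}^{-1}\mathfrak{D}_{t}^{1-\alpha_{2}}G_{2},\\ (1-p)\left(\tfrac{\partial}{\partial t}+U(1)\rho\right)G_{1}+b\left(\tfrac{\partial}{\partial t}+U(2)\rho\right)G_{2} &=(1-p)B_{\alpha_{1}}^{-1}\mathfrak{D}_{t}^{1-\alpha_{1}}G_{1}+(b-1)B_{\alpha_{2}}^{-1}\mathfrak{D}_{t}^{1-\alpha_{2}}G_{2}, \end{aligned} \qquad t\in(0,T],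 $$ with $G_j(t)\to G_{j,0}$ as $t\to0^+$, where $$ \mathfrak{D}^{1-\alpha_{j}}_{t}G_{j}(t)=\left(\frac{\partial}{\partial t}+\rho U(j)\right)\frac{1}{\Gamma(\alpha_{j})}\int_{0}^{t}\frac{e^{-(t-\tau)\rho U(j)}}{(t-\tau)^{1-\alpha_{j}}}\,G_{j}(\tau)\,d\tau . $$ All derivatives occurring here are assumed to exist on $(0,T]$, and are one-sided at $t=T$. Put $m_{1}=\frac{1-p}{1-p-b}$ and $m_{2}=\frac{1-b}{1-p-b}$. Let $\theta\in(\pi/2,\pi)$ and let $\delta>0$ satisfy $$ \delta\geq\max\left\{\max_{j=1,2}\left\{2|\rho U(j)|,\ 4^{1/\alpha_j}|m_{j}B_{\alpha_{j}}^{-1}|^{1/\alpha_{j}}\right\},\ \left(32|m_{1}m_{2}B^{-1}_{\alpha_{1}}B^{-1}_{\alpha_{2}}|\right)^{1/(\alpha_{1}+\alpha_{2})}\right\}. $$ Then for every $t\in(1/\delta,T]$, every $q\in\{0,1\}$ and every $j\in\{1,2\}$, with $j^*$ denoting the other index ($j\cdot j^*=2$), $$ \begin{aligned} \left|\frac{\partial^q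 G_{j}}{\partial t^q}(t)\right|\leq{}& \frac{32\left|m_{j^{*}}B_{\alpha_{j^{*}}}^{-1}\right|}{\pi}\left(\frac{-1}{\cos\theta}\,t^{\alpha_{j^{*}}-q}e^{\cos\theta}+2\theta\,\delta^{q-\alpha_{j^{*}}}e^{\delta T}\right)|G_{j^{*},0}|\\ &+\frac{8}{\pi}\left(\frac{-1}{\cos\theta}\,t^{-q}e^{\cos\theta}+2\theta\,\delta^{q}e^{\delta T}\right)|G_{j,0}| . \end{aligned} $$ -/

import Mathlib

open Set Filter Topology

noncomputable section

namespace FeynmanKac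

/-- The weighted fractional integral
`(1 / Γ(α)) ∫₀ᵗ exp(-(t - τ) c) / (t - τ)^(1 - α) g(τ) dτ` (later `c = ρ U(j)`). -/
def substantialIntegral (α : ℝ) (c : ℂ) (g : ℝ → ℂ) (t : ℝ) : ℂ :=
  ((1 / Real.Gamma α : ℝ) : ℂ) *
    ∫ τ in (0 : ℝ)..t,
      Complex.exp (-((t - τ : ℝ) : ℂ) * c) / (((t - τ) ^ (1 - α) : ℝ) : ℂ) * g τ

/-- Time derivative on `(0, T]`; one-sided at the end point `T`. -/
def timeDeriv (T : ℝ) (g : ℝ → ℂ) (t : ℝ) : ℂ := derivWithin g (Ioc 0 T) t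

/-- The fractional substantial derivative of order `1 - α`,
`(∂/∂t + c)` applied to the weighted fractional integral of order `α`. -/
def substantialDeriv (T α : ℝ) (c : ℂ) (g : ℝ → ℂ) (t : ℝ) : ℂ :=
  timeDeriv T (substantialIntegral α c g) t + c * substantialIntegral α c g t

/-- The numbers `m₁ = (1-p)/(1-p-b)` and `m₂ = (1-b)/(1-p-b)`; the two internal states
are indexed by `0, 1 : Fin 2`. -/
def m (p b : ℝ) : Fin 2 → ℝ := ![(1 - p) / (1 - p - b), (1 - b) / (1 - p - b)]

/-- `G = (G₁, G₂)` is a (classical) solution on `(0, T]` of the Feynman–Kac system with two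
internal states and transition matrix `[[p, 1-p], [1-b, b]]`, with initial value `G₀`. All
derivatives that occur in the system are required to exist. -/
structure IsSolution (T p b : ℝ) (α B U : Fin 2 → ℝ) (ρ : ℂ) (G₀ : Fin 2 → ℂ)
    (G : Fin 2 → ℝ → ℂ) : Prop where
  differentiable : ∀ j, DifferentiableOn ℝ (G j) (Ioc 0 T)
  differentiable_integral : ∀ j,
    DifferentiableOn ℝ (substantialIntegral (α j) (ρ * U j) (G j)) (Ioc 0 T)
  equation_one : ∀ t ∈ Ioc 0 T,
    (p : ℂ) * (timeDeriv T (G 0) t + U 0 * ρ * G 0 t)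
        + (1 - b : ℂ) * (timeDeriv T (G 1) t + U 1 * ρ * G 1 t)
      = (p - 1 : ℂ) * (B 0 : ℂ)⁻¹ * substantialDeriv T (α 0) (ρ * U 0) (G 0) t
        + (1 - b : ℂ) * (B 1 : ℂ)⁻¹ * substantialDeriv T (α 1) (ρ * U 1) (G 1) t
  equation_two : ∀ t ∈ Ioc 0 T,
    (1 - p : ℂ) * (timeDeriv T (G 0) t + U 0 * ρ * G 0 t)
        + (b : ℂ) * (timeDeriv T (G 1) t + U 1 * ρ * G 1 t)
      = (1 - p : ℂ) * (B 0 : ℂ)⁻¹ * substantialDeriv T (α 0) (ρ * U 0) (G 0) t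
        + (b - 1 : ℂ) * (B 1 : ℂ)⁻¹ * substantialDeriv T (α 1) (ρ * U 1) (G 1) t
  initial : ∀ j, Tendsto (G j) (𝓝[>] 0) (𝓝 (G₀ j))

end FeynmanKac

end

noncomputable section

namespace FeynmanKac

open MeasureTheory

/-! A solution is known only on `(0, T]`, so it has no full Laplace transform. The proof works with
transforms truncated at `T` and accepts errors `O(exp (-x T))` for large real `x`. Errors of that
size lose nothing, because a function on `(0, T]` whose truncated transform is that small vanishes
on `(0, T)` when it is continuous there (`integral_eq_zero_of_laplace_decay`,
`eq_zero_of_integral_eq_zero`).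

Let `z` be the Laplace variable, `c_i = ρ U i`, `a_i = m_i / B_i`, and `y_i = (z + c_i) ^ (-α_i)`,
the transform of the fractional kernel. Up to such errors, the transformed system is linear in the
quantities `(z + c_i) X_i`, where `X_i` is the transform of `G_i`. Its determinant is `(1 - a_j
y_j)(1 - a_k y_k) - a_j y_j a_k y_k = 1 - a_j y_j - a_k y_k`, and Cramer's rule gives
`solutionSymbol` (`IsSolution.laplace_eq_solutionSymbol`). The lower bounds on `δ` keep the
determinant away from zero for `|z| ≥ δ` (`determinant_bounds`, `symbol_bounds`).

The inverse Laplace transform of this symbol along two rays of angle `±θ` and an arc of radius `δ`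
has the same truncated transform up to `O(exp (-x T))`, by Fubini and Cauchy's formula
(`laplace_inverseLaplace`). Uniqueness identifies it with the solution
(`IsSolution.eqOn_inverseLaplace`). The estimate then comes from bounding the contour integral:
`norm_exp_mul_solutionSymbol_le` bounds the symbol, `norm_inverseLaplace_le` treats rays and arc,
and a time derivative only adds a factor `z`.

All contour work is done in `ζ = log z`. The contour becomes the boundary of a half-strip, Cauchy's
theorem is needed only on rectangles, and the branch of `z ^ (-α)` becomes `exp (-α ζ)`. -/

/-! ### Uniqueness for truncated Laplace transforms -/

theorem integrableOn_exp_mul {T : ℝ} {f : ℝ → ℂ} (hf : IntegrableOn f (Ioc 0 T)) (x : ℝ) :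
    IntegrableOn (fun t => ((Real.exp (-(x * t)) : ℝ) : ℂ) * f t) (Ioc 0 T) := by
  refine Integrable.bdd_mul (c := Real.exp (|x| * T)) hf
    (Continuous.aestronglyMeasurable (by fun_prop)) ?_
  refine (ae_restrict_iff' measurableSet_Ioc).2 (Eventually.of_forall fun s hs => ?_)
  rw [Complex.norm_real, Real.norm_eq_abs, Real.abs_exp, Real.exp_le_exp]
  calc -(x * s) ≤ |x| * s := by nlinarith [neg_abs_le x, hs.1]
    _ ≤ |x| * T := by gcongr; exact hs.2

/-- A function whose Laplace transform decays like `exp (-n T)` along the integers has vanishing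
integral over every initial segment of `(0, T)`. -/
theorem integral_eq_zero_of_laplace_decay {T C : ℝ} {f : ℝ → ℂ} (hf : IntegrableOn f (Ioc 0 T))
    (n₀ : ℕ) (h : ∀ n : ℕ, n₀ ≤ n →
      ‖∫ t in Ioc 0 T, ((Real.exp (-(n * t)) : ℝ) : ℂ) * f t‖ ≤ C * Real.exp (-(n * T)))
    {s : ℝ} (hs : s ∈ Ioo 0 T) : ∫ t in Ioc 0 s, f t = 0 := by
  -- These weights tend to `-1` for `t < s` and to `0` for `t > s`. Subtracting `1` removes the
  -- constant term of the exponential series, which would require the transform at `0`, where no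
  -- decay is assumed.
  set W : ℕ → ℝ → ℝ := fun n t => Real.exp (-Real.exp (n * (s - t))) - 1 with hW
  have hWm : ∀ n, Continuous (W n) := fun n => by simp only [hW]; fun_prop
  have hWb : ∀ n t, ‖((W n t : ℝ) : ℂ)‖ ≤ 1 := by
    intro n t
    rw [Complex.norm_real, Real.norm_eq_abs, abs_le]
    have h1 := Real.exp_pos (-Real.exp (n * (s - t)))
    have h2 : Real.exp (-Real.exp (n * (s - t))) ≤ 1 := by
      rw [Real.exp_le_one_iff]; linarith [Real.exp_pos (n * (s - t))]
    simp only [hW]; constructor <;> linarith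
  have hlim : Tendsto (fun n => ∫ t in Ioc 0 T, (W n t : ℂ) * f t) atTop
      (𝓝 (∫ t in Ioc 0 T, (Iio s).indicator (fun t => - f t) t)) := by
    refine tendsto_integral_of_dominated_convergence (fun t => ‖f t‖) ?_ hf.norm ?_ ?_
    · intro n
      exact (Complex.continuous_ofReal.comp (hWm n)).aestronglyMeasurable.mul hf.1
    · intro n
      refine Eventually.of_forall fun t => ?_
      rw [norm_mul]
      exact mul_le_of_le_one_left (norm_nonneg _) (hWb n t)
    · have hne : ∀ᵐ t ∂(volume.restrict (Ioc 0 T)), t ≠ s :=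
        ae_restrict_of_ae (by simp [ae_iff])
      filter_upwards [hne] with t ht
      rcases lt_or_gt_of_ne ht with hlt | hgt
      · rw [indicator_of_mem (by exact hlt)]
        have h1 : Tendsto (fun n : ℕ => (n : ℝ) * (s - t)) atTop atTop :=
          tendsto_natCast_atTop_atTop.atTop_mul_const (by linarith)
        have h2 : Tendsto (fun n => W n t) atTop (𝓝 (0 - 1)) :=
          (Real.tendsto_exp_neg_atTop_nhds_zero.comp (Real.tendsto_exp_atTop.comp h1)).sub_const 1
        have h3 := (Complex.continuous_ofReal.tendsto _).comp h2
        simpa using h3.mul_const (f t)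
      · rw [indicator_of_notMem (by simpa using hgt.le)]
        have h1 : Tendsto (fun n : ℕ => (n : ℝ) * (s - t)) atTop atBot :=
          tendsto_natCast_atTop_atTop.atTop_mul_const_of_neg (by linarith)
        have h2 : Tendsto (fun n => W n t) atTop (𝓝 (Real.exp (-0) - 1)) :=
          ((Real.continuous_exp.tendsto _).comp
            ((Real.tendsto_exp_atBot.comp h1).neg)).sub_const 1
        have h3 := (Complex.continuous_ofReal.tendsto _).comp h2
        simpa using h3.mul_const (f t)
  have hC : 0 ≤ C := by
    by_contra hC
    have := (norm_nonneg _).trans (h n₀ le_rfl)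
    nlinarith [Real.exp_pos (-(n₀ * T))]
  -- Expanding the outer exponential turns the weighted integral into a series of transforms at the
  -- integers `n (k + 1)`. The decay hypothesis replaces `exp (-n (k + 1) t)` by `exp (-n (k + 1)
  -- T)`, and the bounds sum to an exponential series again. It tends to `0` because `s < T`.
  have hsmall : ∀ n : ℕ, n₀ ≤ n → ‖∫ t in Ioc 0 T, (W n t : ℂ) * f t‖
      ≤ C * (Real.exp (Real.exp (n * (s - T))) - 1) := by
    intro n hn
    have hexp : ∀ x : ℝ, HasSum (fun k : ℕ => x ^ (k + 1) / ((k + 1).factorial : ℝ))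
        (Real.exp x - 1) := by
      intro x
      have h0 : HasSum (fun k : ℕ => x ^ k / (k.factorial : ℝ)) (Real.exp x) := by
        rw [Real.exp_eq_exp_ℝ]; exact NormedSpace.expSeries_div_hasSum_exp x
      simpa using (hasSum_nat_add_iff' 1).2 h0
    set F : ℕ → ℝ → ℂ := fun k t =>
      (((-Real.exp (n * (s - t))) ^ (k + 1) / ((k + 1).factorial : ℝ) : ℝ) : ℂ) * f t with hF
    have hFeq : ∀ k t, F k t = (((-Real.exp (n * s)) ^ (k + 1) / ((k + 1).factorial : ℝ) : ℝ) : ℂ) *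
        (((Real.exp (-(((n * (k + 1) : ℕ) : ℝ) * t)) : ℝ) : ℂ) * f t) := by
      intro k t
      simp only [hF]
      rw [← mul_assoc, ← Complex.ofReal_mul]
      congr 2
      rw [neg_pow, neg_pow (Real.exp (n * s)), ← Real.exp_nat_mul, ← Real.exp_nat_mul,
        div_mul_eq_mul_div, mul_assoc, ← Real.exp_add]
      push_cast; ring_nf
    have hFi : ∀ k, IntegrableOn (F k) (Ioc 0 T) := by
      intro k
      refine Integrable.bdd_mul (c := Real.exp (n * s) ^ (k + 1) / ((k + 1).factorial : ℝ)) hf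
        (Continuous.aestronglyMeasurable (by fun_prop)) ?_
      refine (ae_restrict_iff' measurableSet_Ioc).2 (Eventually.of_forall fun t ht => ?_)
      rw [Complex.norm_real, norm_div, norm_pow, norm_neg, Real.norm_eq_abs, Real.abs_exp,
        Real.norm_natCast]
      gcongr
      linarith [ht.1]
    have hFn : ∀ k, ∫ t in Ioc 0 T, ‖F k t‖
        ≤ Real.exp (n * s) ^ (k + 1) / ((k + 1).factorial : ℝ) * ∫ t in Ioc 0 T, ‖f t‖ := by
      intro k
      rw [← integral_const_mul]
      refine setIntegral_mono_on (hFi k).norm (hf.norm.const_mul _) measurableSet_Ioc ?_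
      intro t ht
      simp only [hF]
      rw [norm_mul, Complex.norm_real, norm_div, norm_pow, norm_neg, Real.norm_eq_abs,
        Real.abs_exp, Real.norm_natCast]
      gcongr
      linarith [ht.1]
    have hsum := hasSum_integral_of_summable_integral_norm hFi
      (Summable.of_nonneg_of_le (fun k => integral_nonneg fun _ => norm_nonneg _) hFn
        ((hexp (Real.exp (n * s))).summable.mul_right _))
    have htsum : ∀ t, ∑' k, F k t = (W n t : ℂ) * f t := fun t =>
      ((Complex.hasSum_ofReal.2 (hexp (-Real.exp (n * (s - t))))).mul_right (f t)).tsum_eq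
    simp only [htsum] at hsum
    rw [← hsum.tsum_eq]
    refine tsum_of_norm_bounded ((hexp (Real.exp (n * (s - T)))).mul_left C) fun k => ?_
    simp only [hFeq]
    rw [integral_const_mul, norm_mul, Complex.norm_real, norm_div, norm_pow, norm_neg,
      Real.norm_eq_abs, Real.abs_exp, Real.norm_natCast]
    have hk := h (n * (k + 1)) (hn.trans (Nat.le_mul_of_pos_right _ k.succ_pos))
    calc _ ≤ Real.exp (n * s) ^ (k + 1) / ((k + 1).factorial : ℝ) *
          (C * Real.exp (-(((n * (k + 1) : ℕ) : ℝ) * T))) := by gcongr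
      _ = _ := by
        rw [← Real.exp_nat_mul, ← Real.exp_nat_mul,
          show ((k + 1 : ℕ) : ℝ) * (n * (s - T)) = (k + 1 : ℕ) * (n * s) +
            (-(((n * (k + 1) : ℕ) : ℝ) * T)) by push_cast; ring, Real.exp_add]
        ring
  have hzero : Tendsto (fun n => ∫ t in Ioc 0 T, (W n t : ℂ) * f t) atTop (𝓝 0) := by
    have h1 : Tendsto (fun n : ℕ => (n : ℝ) * (s - T)) atTop atBot :=
      tendsto_natCast_atTop_atTop.atTop_mul_const_of_neg (by linarith [hs.2])
    have h2 : Tendsto (fun n : ℕ => C * (Real.exp (Real.exp (n * (s - T))) - 1)) atTop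
        (𝓝 (C * (Real.exp 0 - 1))) :=
      (((Real.continuous_exp.tendsto _).comp (Real.tendsto_exp_atBot.comp h1)).sub_const 1).const_mul C
    rw [Real.exp_zero, sub_self, mul_zero] at h2
    exact squeeze_zero_norm' (eventually_atTop.2 ⟨n₀, hsmall⟩) h2
  have h0 := tendsto_nhds_unique hlim hzero
  rw [setIntegral_indicator measurableSet_Iio, integral_neg, neg_eq_zero] at h0
  rw [← h0, integral_Ioc_eq_integral_Ioo]
  congr 2
  ext t
  simp only [mem_Ioo, mem_inter_iff, mem_Ioc, mem_Iio]
  constructor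
  · rintro ⟨h1, h2⟩; exact ⟨⟨h1, by linarith [hs.2]⟩, h2⟩
  · rintro ⟨⟨h1, _⟩, h2⟩; exact ⟨h1, h2⟩

/-! ### Laplace transforms of powers, convolutions and superpositions of exponentials -/

theorem integrableOn_rpow_mul_cexp {α : ℝ} (hα : 0 < α) {r : ℂ} (hr : 0 < r.re) :
    IntegrableOn (fun s : ℝ => ((s ^ (α - 1) : ℝ) : ℂ) * Complex.exp (-(r * s))) (Ioi 0) := by
  have h := integrableOn_rpow_mul_exp_neg_mul_rpow (p := 1) (s := α - 1) (b := r.re)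
    (by linarith) one_pos hr
  refine Integrable.mono' h ?_ ?_
  · exact (Measurable.aestronglyMeasurable (by fun_prop))
  · refine (ae_restrict_iff' measurableSet_Ioi).2 (Eventually.of_forall fun s hs => ?_)
    rw [norm_mul, Complex.norm_real, Complex.norm_exp, Real.norm_of_nonneg
      (Real.rpow_nonneg (le_of_lt hs) _)]
    simp

/-- The Laplace transform of `s ^ (α - 1)` in the open right half-plane. -/
theorem integral_rpow_mul_cexp {α : ℝ} (hα : 0 < α) {r : ℂ} (hr : 0 < r.re) :
    ∫ s in Ioi (0 : ℝ), ((s ^ (α - 1) : ℝ) : ℂ) * Complex.exp (-(r * s))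
      = r ^ (-α : ℂ) * Real.Gamma α := by
  set S : Set ℂ := {z | 0 < z.re} with hS
  have hSo : IsOpen S := isOpen_lt continuous_const Complex.continuous_re
  have hSc : IsPreconnected S := (convex_halfSpace_re_gt 0).isPreconnected
  set f : ℂ → ℂ := fun r => ∫ s in Ioi (0 : ℝ), ((s ^ (α - 1) : ℝ) : ℂ) * Complex.exp (-(r * s))
  have hf : DifferentiableOn ℂ f S := by
    intro r₀ hr₀
    have hr₀' : 0 < r₀.re := hr₀
    have hb := integrableOn_rpow_mul_exp_neg_mul_rpow (p := 1) (s := α) (b := r₀.re / 2)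
      (by linarith) one_pos (by linarith)
    refine (hasDerivAt_integral_of_dominated_loc_of_deriv_le
      (F := fun (r : ℂ) (s : ℝ) => ((s ^ (α - 1) : ℝ) : ℂ) * Complex.exp (-(r * s)))
      (F' := fun (r : ℂ) (s : ℝ) => ((s ^ (α - 1) : ℝ) : ℂ) * (Complex.exp (-(r * s)) * (-s)))
      (s := {z | r₀.re / 2 < z.re})
      ((isOpen_lt continuous_const Complex.continuous_re).mem_nhds
        (show r₀.re / 2 < r₀.re by linarith))
      (Eventually.of_forall fun r => Measurable.aestronglyMeasurable (by fun_prop))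
      (integrableOn_rpow_mul_cexp hα hr₀')
      (Measurable.aestronglyMeasurable (by fun_prop)) ?_ hb
      ?_).2.differentiableAt.differentiableWithinAt
    · refine (ae_restrict_iff' measurableSet_Ioi).2 (Eventually.of_forall fun s hs r hr => ?_)
      have hs' : 0 < s := hs
      have hr' : r₀.re / 2 < r.re := hr
      rw [norm_mul, norm_mul, Complex.norm_real, Complex.norm_exp, norm_neg, Complex.norm_real,
        Real.norm_of_nonneg (Real.rpow_nonneg hs'.le _), Real.norm_of_nonneg hs'.le,
        Real.rpow_sub_one hs'.ne']
      have he : Real.exp (-(r * s)).re ≤ Real.exp (-(r₀.re / 2) * s ^ (1 : ℝ)) := by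
        apply Real.exp_le_exp.2
        simp
        nlinarith
      calc _ = s ^ α * Real.exp (-(r * s)).re := by field_simp
        _ ≤ _ := by gcongr
    · refine Eventually.of_forall fun s r _ => ?_
      have h1 : HasDerivAt (fun r : ℂ => -(r * (s : ℂ))) (-(s : ℂ)) r := by
        simpa using! ((hasDerivAt_id r).mul_const (s : ℂ)).neg
      exact h1.cexp.const_mul _
  have hg : DifferentiableOn ℂ (fun r : ℂ => r ^ (-α : ℂ) * Real.Gamma α) S := by
    intro r hr
    exact ((differentiableAt_id.cpow_const (Or.inl hr)).mul_const _).differentiableWithinAt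
  have hreal : ∀ x : ℝ, 0 < x → f x = (x : ℂ) ^ (-α : ℂ) * Real.Gamma α := by
    intro x hx
    have h := Complex.integral_cpow_mul_exp_neg_mul_Ioi (a := α) (r := x) (by simpa) hx
    have harg : (x : ℂ).arg ≠ Real.pi := by
      rw [Complex.arg_ofReal_of_nonneg hx.le]
      exact Real.pi_pos.ne
    rw [one_div, Complex.inv_cpow _ _ harg, ← Complex.cpow_neg, Complex.Gamma_ofReal] at h
    rw [← h]
    refine setIntegral_congr_fun measurableSet_Ioi fun s hs => ?_
    have hs' : (0 : ℝ) ≤ s := le_of_lt hs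
    rw [Complex.ofReal_cpow hs']
    push_cast
    rfl
  -- Identity theorem: both sides are holomorphic on the half-plane and agree at the real points
  -- near `1`.
  refine AnalyticOnNhd.eqOn_of_preconnected_of_frequently_eq (hf.analyticOnNhd hSo)
    (hg.analyticOnNhd hSo) hSc (z₀ := 1) (by simp [hS]) ?_ hr
  have ht : Tendsto (fun x : ℝ => (x : ℂ)) (𝓝[≠] 1) (𝓝[≠] (1 : ℂ)) := by
    refine tendsto_nhdsWithin_iff.2 ⟨?_, ?_⟩
    · exact (Complex.continuous_ofReal.tendsto' 1 1 (by simp)).mono_left nhdsWithin_le_nhds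
    · filter_upwards [self_mem_nhdsWithin] with x hx
      simpa using hx
  refine ht.frequently (Eventually.frequently ?_)
  filter_upwards [nhdsWithin_le_nhds (Ioi_mem_nhds (zero_lt_one' ℝ))] with x hx
  exact hreal x hx

/-- The Laplace transform, truncated at time `T`, of a convolution is the product of the
transforms up to an error `O(exp (-x T))`. -/
theorem laplace_convolution {T x₀ : ℝ} (hT : 0 < T) {k g : ℝ → ℂ}
    (hk : IntegrableOn (fun s => ((Real.exp (-(x₀ * s)) : ℝ) : ℂ) * k s) (Ioi 0))
    (hg : IntegrableOn g (Ioc 0 T)) :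
    ∃ C, ∀ x, x₀ ≤ x →
      ‖(∫ t in Ioc 0 T, ((Real.exp (-(x * t)) : ℝ) : ℂ) * ∫ τ in (0 : ℝ)..t, k (t - τ) * g τ) -
        (∫ s in Ioi 0, ((Real.exp (-(x * s)) : ℝ) : ℂ) * k s) *
          ∫ t in Ioc 0 T, ((Real.exp (-(x * t)) : ℝ) : ℂ) * g t‖ ≤ C * Real.exp (-(x * T)) := by
  set h : ℝ → ℂ := (Ioc 0 T).indicator g with hh
  have hhi : Integrable h := (integrable_indicator_iff measurableSet_Ioc).2 hg
  set c : ℝ → ℂ := fun t => ∫ τ in (0 : ℝ)..t, h τ * k (t - τ) with hc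
  have hki : ∀ x, x₀ ≤ x →
      IntegrableOn (fun s => ((Real.exp (-(x * s)) : ℝ) : ℂ) * k s) (Ioi 0) := by
    intro x hx
    have h1 : IntegrableOn (fun s => ((Real.exp (-((x - x₀) * s)) : ℝ) : ℂ) *
        (((Real.exp (-(x₀ * s)) : ℝ) : ℂ) * k s)) (Ioi 0) := by
      refine Integrable.bdd_mul (c := 1) hk (Continuous.aestronglyMeasurable (by fun_prop)) ?_
      refine (ae_restrict_iff' measurableSet_Ioi).2 (Eventually.of_forall fun s hs => ?_)
      rw [Complex.norm_real, Real.norm_eq_abs, Real.abs_exp, Real.exp_le_one_iff]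
      have : 0 ≤ (x - x₀) * s := mul_nonneg (by linarith) (le_of_lt hs)
      linarith
    refine h1.congr_fun (fun s _ => ?_) measurableSet_Ioi
    simp only
    rw [← mul_assoc, ← Complex.ofReal_mul, ← Real.exp_add]
    ring_nf
  have hhi' : ∀ x, IntegrableOn (fun s => ((Real.exp (-(x * s)) : ℝ) : ℂ) * h s) (Ioi 0) := by
    intro x
    have h1 := integrableOn_exp_mul hg x
    have h2 := (integrable_indicator_iff measurableSet_Ioc).2 h1
    refine (h2.congr (Eventually.of_forall fun s => ?_)).integrableOn
    by_cases hs : s ∈ Ioc 0 T <;> simp [hh, hs]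
  have hconv : ∀ x t, ∫ τ in (0 : ℝ)..t, (ContinuousLinearMap.mul ℝ ℂ
      (((Real.exp (-(x * τ)) : ℝ) : ℂ) * h τ)) (((Real.exp (-(x * (t - τ))) : ℝ) : ℂ) * k (t - τ))
      = ((Real.exp (-(x * t)) : ℝ) : ℂ) * c t := by
    intro x t
    rw [hc, ← intervalIntegral.integral_const_mul]
    congr 1
    ext τ
    rw [ContinuousLinearMap.mul_apply', show -(x * t) = -(x * τ) + -(x * (t - τ)) by ring,
      Real.exp_add]
    push_cast; ring
  have hci : ∀ x, x₀ ≤ x → IntegrableOn (fun t => ((Real.exp (-(x * t)) : ℝ) : ℂ) * c t) (Ioi 0) := by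
    intro x hx
    have := integrable_posConvolution (hhi' x) (hki x hx) (ContinuousLinearMap.mul ℝ ℂ)
    rw [posConvolution, integrable_indicator_iff measurableSet_Ioi] at this
    simpa only [hconv] using this
  have hprod : ∀ x, x₀ ≤ x → ∫ t in Ioi 0, ((Real.exp (-(x * t)) : ℝ) : ℂ) * c t =
      (∫ t in Ioc 0 T, ((Real.exp (-(x * t)) : ℝ) : ℂ) * g t) *
        ∫ s in Ioi 0, ((Real.exp (-(x * s)) : ℝ) : ℂ) * k s := by
    intro x hx
    have := integral_posConvolution (hhi' x) (hki x hx) (ContinuousLinearMap.mul ℝ ℂ)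
    simp only [hconv] at this
    rw [this, ContinuousLinearMap.mul_apply']
    congr 1
    have h3 : ∀ t, ((Real.exp (-(x * t)) : ℝ) : ℂ) * h t =
        (Ioc 0 T).indicator (fun t => ((Real.exp (-(x * t)) : ℝ) : ℂ) * g t) t := by
      intro s
      by_cases hs : s ∈ Ioc 0 T <;> simp [hh, hs]
    simp only [h3]
    rw [setIntegral_indicator measurableSet_Ioc, inter_eq_self_of_subset_right
      (fun s hs => hs.1)]
  -- With `g` extended by zero, the product formula is exact on `(0, ∞)`, so the error is the tail
  -- beyond `T`. There `exp (-x t) ≤ exp (-(x - x₀) T) * exp (-x₀ t)`, which gives this constant.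
  refine ⟨Real.exp (x₀ * T) * ∫ t in Ioi T, ‖((Real.exp (-(x₀ * t)) : ℝ) : ℂ) * c t‖,
    fun x hx => ?_⟩
  have hcin : ∫ t in Ioc 0 T, ((Real.exp (-(x * t)) : ℝ) : ℂ) *
      (∫ τ in (0 : ℝ)..t, k (t - τ) * g τ) =
      ∫ t in Ioc 0 T, ((Real.exp (-(x * t)) : ℝ) : ℂ) * c t := by
    refine setIntegral_congr_fun measurableSet_Ioc fun t ht => ?_
    simp only [hc]
    congr 1
    refine intervalIntegral.integral_congr_ae (Eventually.of_forall fun τ hτ => ?_)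
    rw [uIoc_of_le ht.1.le] at hτ
    rw [hh, indicator_of_mem (show τ ∈ Ioc 0 T from ⟨hτ.1, hτ.2.trans ht.2⟩), mul_comm]
  have hsplit : ∫ t in Ioi 0, ((Real.exp (-(x * t)) : ℝ) : ℂ) * c t =
      (∫ t in Ioc 0 T, ((Real.exp (-(x * t)) : ℝ) : ℂ) * c t) +
        ∫ t in Ioi T, ((Real.exp (-(x * t)) : ℝ) : ℂ) * c t := by
    rw [← Ioc_union_Ioi_eq_Ioi hT.le]
    refine setIntegral_union (Ioc_disjoint_Ioi le_rfl) measurableSet_Ioi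
      ((hci x hx).mono_set Ioc_subset_Ioi_self) ((hci x hx).mono_set (Ioi_subset_Ioi hT.le))
  rw [hcin, mul_comm (∫ s in Ioi 0, _), ← hprod x hx, hsplit, sub_add_cancel_left, norm_neg]
  refine (norm_integral_le_integral_norm _).trans ?_
  rw [mul_right_comm, ← Real.exp_add, ← integral_const_mul]
  refine setIntegral_mono_on ((hci x hx).mono_set (Ioi_subset_Ioi hT.le)).norm
    (((hci x₀ le_rfl).mono_set (Ioi_subset_Ioi hT.le)).norm.const_mul _) measurableSet_Ioi ?_
  intro t ht
  have ht' : T < t := ht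
  rw [norm_mul, norm_mul, ← mul_assoc, Complex.norm_real, Complex.norm_real, Real.norm_eq_abs,
    Real.norm_eq_abs, Real.abs_exp, Real.abs_exp, ← Real.exp_add]
  gcongr
  nlinarith

/-- An integral superposition of exponentials `exp (t z)`: its Laplace transform truncated at
time `T` is the superposition of `1 / (x - z)`, up to an error `O(exp (-x T))`. -/
theorem laplace_superposition {Y : Type*} [MeasurableSpace Y] {ν : Measure Y} [SFinite ν]
    {z f : Y → ℂ} (hz : Measurable z) {M x₀ T : ℝ} (hT : 0 < T) (hM : ∀ y, (z y).re ≤ M)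
    (hMx : M < x₀) (hf : Integrable (fun y => f y / ((x₀ - (z y).re : ℝ) : ℂ)) ν) :
    IntegrableOn (fun t : ℝ => ∫ y, Complex.exp (t * z y) * f y ∂ν) (Ioc 0 T) ∧
    ∃ C, ∀ x, x₀ ≤ x →
      ‖(∫ t in Ioc 0 T, ((Real.exp (-(x * t)) : ℝ) : ℂ) * ∫ y, Complex.exp (t * z y) * f y ∂ν) -
        ∫ y, f y / (x - z y) ∂ν‖ ≤ C * Real.exp (-(x * T)) := by
  have hpos : ∀ x, x₀ ≤ x → ∀ y, 0 < x - (z y).re := fun x hx y => by linarith [hM y]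
  have hfm : AEStronglyMeasurable f ν := by
    have h1 : AEStronglyMeasurable (fun y => ((x₀ - (z y).re : ℝ) : ℂ)) ν :=
      Measurable.aestronglyMeasurable (by fun_prop)
    refine (hf.1.mul h1).congr (Eventually.of_forall fun y => ?_)
    have : ((x₀ - (z y).re : ℝ) : ℂ) ≠ 0 := Complex.ofReal_ne_zero.2 (hpos x₀ le_rfl y).ne'
    simp only [Pi.mul_apply]
    field_simp
  have hnorm : ∀ (x : ℝ) (y : Y) (t : ℝ),
      ‖Complex.exp ((z y - x) * t) * f y‖ = Real.exp (((z y).re - x) * t) * ‖f y‖ := by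
    intro x y t
    rw [norm_mul, Complex.norm_exp]
    simp
  -- Integrating in `t` first gains a factor at most `1 / (x₀ - Re z)`. Hence `f` need not be
  -- integrable itself: on the infinite rays of the contour it will only be bounded.
  have hint : ∀ x : ℝ, x₀ ≤ x → Integrable (Function.uncurry fun (t : ℝ) (y : Y) =>
      Complex.exp ((z y - x) * t) * f y) ((volume.restrict (Ioc 0 T)).prod ν) := by
    intro x hx
    have hm : AEStronglyMeasurable (Function.uncurry fun (t : ℝ) (y : Y) =>
        Complex.exp ((z y - x) * t) * f y) ((volume.restrict (Ioc 0 T)).prod ν) := by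
      refine AEStronglyMeasurable.mul (f := fun p : ℝ × Y => Complex.exp ((z p.2 - x) * p.1))
        (g := fun p : ℝ × Y => f p.2) ?_ hfm.comp_snd
      exact Measurable.aestronglyMeasurable (by fun_prop)
    rw [integrable_prod_iff' hm]
    constructor
    · refine Eventually.of_forall fun y => ?_
      exact ((Continuous.integrableOn_Icc (by simp only [Function.uncurry]; fun_prop)).mono_set
        Ioc_subset_Icc_self)
    · refine Integrable.mono' hf.norm ?_ (Eventually.of_forall fun y => ?_)
      · exact hm.norm.prod_swap.integral_prod_right'
      · simp only [Function.uncurry]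
        rw [Real.norm_of_nonneg (integral_nonneg fun _ => norm_nonneg _)]
        simp only [hnorm]
        have hp := hpos x₀ le_rfl y
        have hp' := hpos x hx y
        have hval : ∫ t in (0 : ℝ)..T, Real.exp (((z y).re - x) * t) =
            (1 - Real.exp (((z y).re - x) * T)) / (x - (z y).re) := by
          have h1 : (z y).re - x ≠ 0 := by linarith
          have h2 : x - (z y).re ≠ 0 := by linarith
          rw [intervalIntegral.integral_comp_mul_left (fun t => Real.exp t) h1, integral_exp,
            mul_zero, Real.exp_zero, smul_eq_mul, inv_mul_eq_div, div_eq_div_iff h1 h2]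
          ring
        rw [integral_mul_const, ← intervalIntegral.integral_of_le hT.le, hval, norm_div,
          Complex.norm_real, Real.norm_of_nonneg hp.le, div_mul_eq_mul_div]
        gcongr
        exact mul_le_of_le_one_left (norm_nonneg _)
          (by linarith [Real.exp_pos (((z y).re - x) * T)])
  have hfac : ∀ x t : ℝ, ∫ y, Complex.exp ((z y - x) * t) * f y ∂ν =
      ((Real.exp (-(x * t)) : ℝ) : ℂ) * ∫ y, Complex.exp (t * z y) * f y ∂ν := by
    intro x t
    rw [← integral_const_mul]
    congr 1
    ext y
    rw [← mul_assoc, Complex.ofReal_exp, ← Complex.exp_add]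
    push_cast
    ring_nf
  have hres : ∀ x, x₀ ≤ x → ∀ y, ‖f y / (x - z y)‖ ≤ ‖f y / ((x₀ - (z y).re : ℝ) : ℂ)‖ := by
    intro x hx y
    have hp := hpos x₀ le_rfl y
    rw [norm_div, norm_div, Complex.norm_real, Real.norm_of_nonneg hp.le]
    gcongr
    calc x₀ - (z y).re ≤ ((x : ℂ) - z y).re := by simp; linarith
      _ ≤ _ := Complex.re_le_norm _
  constructor
  · have h1 := (hint x₀ le_rfl).integral_prod_left
    simp only [Function.uncurry, hfac] at h1
    refine (integrableOn_exp_mul h1 (-x₀)).congr_fun (fun t _ => ?_) measurableSet_Ioc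
    simp only
    rw [← mul_assoc, ← Complex.ofReal_mul, ← Real.exp_add, neg_mul, neg_neg, add_neg_cancel,
      Real.exp_zero, Complex.ofReal_one, one_mul]
  · refine ⟨Real.exp (M * T) * ∫ y, ‖f y / ((x₀ - (z y).re : ℝ) : ℂ)‖ ∂ν, fun x hx => ?_⟩
    have hne : ∀ y, (x : ℂ) - z y ≠ 0 := fun y h0 => by
      have := congrArg Complex.re h0
      simp at this
      linarith [hpos x hx y]
    have hxz : AEStronglyMeasurable (fun y => f y / (x - z y)) ν :=
      hfm.mul (g := fun y => ((x : ℂ) - z y)⁻¹) (Measurable.aestronglyMeasurable (by fun_prop))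
    have hxzi : Integrable (fun y => f y / (x - z y)) ν :=
      hf.mono hxz (Eventually.of_forall (hres x hx))
    have hb : ∀ y, ‖Complex.exp ((z y - x) * T) * (f y / (x - z y))‖ ≤
        Real.exp (M * T) * Real.exp (-(x * T)) * ‖f y / ((x₀ - (z y).re : ℝ) : ℂ)‖ := by
      intro y
      rw [norm_mul, ← Real.exp_add, Complex.norm_exp]
      refine mul_le_mul (Real.exp_le_exp.2 ?_) (hres x hx y) (norm_nonneg _) (Real.exp_pos _).le
      simp
      nlinarith [hM y]
    have hexi : Integrable (fun y => Complex.exp ((z y - x) * T) * (f y / (x - z y))) ν := by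
      refine Integrable.mono' (hf.norm.const_mul (Real.exp (M * T) * Real.exp (-(x * T)))) ?_
        (Eventually.of_forall hb)
      exact AEStronglyMeasurable.mul (Measurable.aestronglyMeasurable (by fun_prop)) hxz
    -- After Fubini, the endpoint `t = 0` gives the main term and `t = T` gives the error, of size
    -- `exp ((M - x) T)`.
    have hswap : ∫ t in Ioc 0 T, ((Real.exp (-(x * t)) : ℝ) : ℂ) *
        ∫ y, Complex.exp (t * z y) * f y ∂ν =
        ∫ y, (f y / (x - z y) - Complex.exp ((z y - x) * T) * (f y / (x - z y))) ∂ν := by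
      simp only [← hfac]
      rw [integral_integral_swap (hint x hx)]
      congr 1
      ext y
      have h1 : z y - x ≠ 0 := fun h0 => hne y (by rw [← neg_sub, h0, neg_zero])
      rw [integral_mul_const, ← intervalIntegral.integral_of_le hT.le,
        integral_exp_mul_complex h1]
      have h2 := hne y
      simp only [Complex.ofReal_zero, mul_zero, Complex.exp_zero]
      rw [← neg_sub (x : ℂ) (z y)]
      field_simp
      ring
    rw [hswap, integral_sub hxzi hexi, sub_sub_cancel_left, norm_neg]
    refine (norm_integral_le_integral_norm _).trans ?_
    rw [mul_right_comm, ← integral_const_mul]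
    exact integral_mono hexi.norm (hf.norm.const_mul _) hb

/-- Differentiation under the integral sign for a superposition of exponentials. -/
theorem hasDerivAt_superposition {Y : Type*} [MeasurableSpace Y] {ν : Measure Y}
    {z f : Y → ℂ} (hz : Measurable z) (hfm : AEStronglyMeasurable f ν)
    (h0 : ∀ t : ℝ, 0 < t → Integrable (fun y => Complex.exp (t * z y) * f y) ν)
    (h1 : ∀ t : ℝ, 0 < t → Integrable (fun y => Complex.exp (t * z y) * (z y * f y)) ν)
    {t : ℝ} (ht : 0 < t) :
    HasDerivAt (fun t : ℝ => ∫ y, Complex.exp (t * z y) * f y ∂ν)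
      (∫ y, Complex.exp (t * z y) * (z y * f y) ∂ν) t := by
  refine (hasDerivAt_integral_of_dominated_loc_of_deriv_le
    (F := fun (t : ℝ) y => Complex.exp (t * z y) * f y)
    (F' := fun (t : ℝ) y => Complex.exp (t * z y) * (z y * f y))
    -- The modulus of `exp (s z)` is monotone in `s`, in a direction set by the sign of `Re z`. The
    -- sum of the values at both ends of the interval dominates either way.
    (bound := fun y => ‖Complex.exp ((t / 2 : ℝ) * z y) * (z y * f y)‖ +
      ‖Complex.exp ((2 * t : ℝ) * z y) * (z y * f y)‖)
    (s := Ioo (t / 2) (2 * t)) (Ioo_mem_nhds (by linarith) (by linarith))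
    (Eventually.of_forall fun s => ?_) (h0 t ht) (h1 t ht).1 ?_
    ((h1 _ (by linarith)).norm.add (h1 _ (by linarith)).norm) ?_).2
  · exact AEStronglyMeasurable.mul (Measurable.aestronglyMeasurable (by fun_prop)) hfm
  · refine Eventually.of_forall fun y s hs => ?_
    simp only [norm_mul, Complex.norm_exp, Complex.re_ofReal_mul]
    rw [← add_mul]
    gcongr
    rcases le_total 0 (z y).re with h | h
    · have : Real.exp (s * (z y).re) ≤ Real.exp (2 * t * (z y).re) := by
        gcongr; exact hs.2.le
      linarith [Real.exp_pos (t / 2 * (z y).re)]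
    · have : Real.exp (s * (z y).re) ≤ Real.exp (t / 2 * (z y).re) :=
        Real.exp_le_exp.2 (mul_le_mul_of_nonpos_right hs.1.le h)
      linarith [Real.exp_pos (2 * t * (z y).re)]
  · refine Eventually.of_forall fun y s _ => ?_
    have h2 : HasDerivAt (fun s : ℝ => (s : ℂ) * z y) (z y) s := by
      simpa using (Complex.ofRealCLM.hasDerivAt (x := s)).mul_const (z y)
    simpa only [mul_assoc] using h2.cexp.mul_const (f y)

/-! ### Cauchy's theorem and formula on a half-strip -/

/-- The integral of `Q` over the boundary of the half-strip `Re ζ ≥ L`, `|Im ζ| ≤ θ`. Under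
`z = exp ζ` it corresponds to the Hankel-type contour formed by two rays and a circular arc. -/
def contour (L θ : ℝ) (Q : ℂ → ℂ) : ℂ :=
  (∫ s in Ioi L, Q (s + θ * Complex.I)) - (∫ s in Ioi L, Q (s + (-θ : ℝ) * Complex.I))
    + Complex.I * ∫ φ in (-θ)..θ, Q (L + φ * Complex.I)

theorem integrableOn_ray {L η C : ℝ} {Q : ℂ → ℂ}
    (hQ : ∀ s : ℝ, L ≤ s → ContinuousAt Q (s + η * Complex.I))
    (hC : ∀ s : ℝ, L ≤ s → ‖Q (s + η * Complex.I)‖ ≤ C * Real.exp (-s)) :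
    IntegrableOn (fun s : ℝ => Q (s + η * Complex.I)) (Ioi L) := by
  have h1 : IntegrableOn (fun s : ℝ => C * Real.exp (-s)) (Ioi L) :=
    (integrableOn_exp_neg_Ioi L).const_mul C
  refine Integrable.mono' h1 ?_ ?_
  · refine ContinuousOn.aestronglyMeasurable (fun s hs => ?_) measurableSet_Ioi
    exact ((hQ s (le_of_lt hs)).comp (f := fun s : ℝ => (s : ℂ) + η * Complex.I)
      (by fun_prop)).continuousWithinAt
  · exact (ae_restrict_iff' measurableSet_Ioi).2 (Eventually.of_forall fun s hs => hC s (le_of_lt hs))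

/-- Cauchy's theorem on the half-strip for an exponentially decaying integrand. -/
theorem contour_eq_zero {L θ C b₀ : ℝ} (hθ : 0 < θ) {Q : ℂ → ℂ} {S : Set ℂ} (hS : S.Countable)
    (hc : ∀ ζ : ℂ, L ≤ ζ.re → |ζ.im| ≤ θ → ContinuousAt Q ζ)
    (hd : ∀ ζ : ℂ, L ≤ ζ.re → |ζ.im| ≤ θ → ζ ∉ S → DifferentiableAt ℂ Q ζ)
    (hC : ∀ ζ : ℂ, b₀ ≤ ζ.re → |ζ.im| ≤ θ → ‖Q ζ‖ ≤ C * Real.exp (-ζ.re))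
    (hi : ∀ η : ℝ, |η| = θ → IntegrableOn (fun s : ℝ => Q (s + η * Complex.I)) (Ioi L)) :
    contour L θ Q = 0 := by
  -- Cauchy on the rectangle cut off at `Re ζ = b`; the right side has fixed length and its
  -- integrand decays, so it disappears as `b → ∞`.
  have hrect : ∀ b : ℝ, L ≤ b →
      (∫ s in L..b, Q (s + θ * Complex.I)) - (∫ s in L..b, Q (s + (-θ : ℝ) * Complex.I))
        + Complex.I * (∫ φ in (-θ)..θ, Q (L + φ * Complex.I))
        - Complex.I * (∫ φ in (-θ)..θ, Q (b + φ * Complex.I)) = 0 := by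
    intro b hb
    have h := Complex.integral_boundary_rect_eq_zero_of_differentiable_on_off_countable Q
      (⟨L, -θ⟩ : ℂ) (⟨b, θ⟩ : ℂ) S hS ?_ ?_
    · simp only [smul_eq_mul] at h
      linear_combination -h
    · intro ζ hζ
      rw [Complex.mem_reProdIm, uIcc_of_le (by exact hb), uIcc_of_le (by simp; linarith)] at hζ
      exact (hc ζ hζ.1.1 (abs_le.2 hζ.2)).continuousWithinAt
    · rintro ζ ⟨hζ, hζS⟩
      rw [Complex.mem_reProdIm, min_eq_left (by exact hb), max_eq_right (by exact hb),
        min_eq_left (by simp; linarith), max_eq_right (by simp; linarith)] at hζ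
      exact hd ζ hζ.1.1.le (abs_le.2 ⟨hζ.2.1.le, hζ.2.2.le⟩) hζS
  have hright : Tendsto (fun b : ℝ => ∫ φ in (-θ)..θ, Q (b + φ * Complex.I)) atTop (𝓝 0) := by
    have h1 : Tendsto (fun b : ℝ => C * Real.exp (-b) * |θ - -θ|) atTop
        (𝓝 (C * 0 * |θ - -θ|)) :=
      (Real.tendsto_exp_neg_atTop_nhds_zero.const_mul C).mul_const _
    rw [mul_zero, zero_mul] at h1
    refine squeeze_zero_norm' (eventually_atTop.2 ⟨b₀, fun b hb => ?_⟩) h1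
    refine intervalIntegral.norm_integral_le_of_norm_le_const fun φ hφ => ?_
    rw [uIoc_of_le (by linarith)] at hφ
    have := hC (b + φ * Complex.I) (by simpa using hb)
      (by simpa using abs_le.2 ⟨hφ.1.le, hφ.2⟩)
    simpa using this
  have hlim := (((intervalIntegral_tendsto_integral_Ioi L (hi θ (abs_of_pos hθ)) tendsto_id).sub
    (intervalIntegral_tendsto_integral_Ioi L (hi (-θ) (by rw [abs_neg, abs_of_pos hθ]))
      tendsto_id)).add_const
    (Complex.I * ∫ φ in (-θ)..θ, Q (L + φ * Complex.I))).sub (hright.const_mul Complex.I)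
  have h0 := tendsto_nhds_unique (hlim.congr' (eventually_atTop.2 ⟨L, hrect⟩)) tendsto_const_nhds
  rw [mul_zero, sub_zero] at h0
  exact h0

theorem contour_congr {L θ : ℝ} (hθ : 0 < θ) {Q Q' : ℂ → ℂ}
    (h : ∀ ζ : ℂ, L ≤ ζ.re → |ζ.im| ≤ θ → (ζ.re = L ∨ |ζ.im| = θ) → Q ζ = Q' ζ) :
    contour L θ Q = contour L θ Q' := by
  have hray : ∀ η : ℝ, |η| = θ → ∫ s in Ioi L, Q (s + η * Complex.I) =
      ∫ s in Ioi L, Q' (s + η * Complex.I) := by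
    intro η hη
    refine setIntegral_congr_fun measurableSet_Ioi fun s hs => ?_
    exact h _ (by simpa using le_of_lt hs) (by simp [hη]) (Or.inr (by simp [hη]))
  have hseg : ∫ φ in (-θ)..θ, Q (L + φ * Complex.I) = ∫ φ in (-θ)..θ, Q' (L + φ * Complex.I) := by
    refine intervalIntegral.integral_congr fun φ hφ => ?_
    rw [uIcc_of_le (by linarith)] at hφ
    exact h _ (by simp) (by simpa using abs_le.2 hφ) (Or.inl (by simp))
  rw [contour, contour, hray θ (abs_of_pos hθ), hray (-θ) (by rw [abs_neg, abs_of_pos hθ]), hseg]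

theorem contour_sub {L θ : ℝ} (hθ : 0 < θ) {Q Q' : ℂ → ℂ}
    (h : ∀ η : ℝ, |η| = θ → IntegrableOn (fun s : ℝ => Q (s + η * Complex.I)) (Ioi L))
    (h' : ∀ η : ℝ, |η| = θ → IntegrableOn (fun s : ℝ => Q' (s + η * Complex.I)) (Ioi L))
    (hs : IntervalIntegrable (fun φ : ℝ => Q (L + φ * Complex.I)) volume (-θ) θ)
    (hs' : IntervalIntegrable (fun φ : ℝ => Q' (L + φ * Complex.I)) volume (-θ) θ) :
    contour L θ (fun ζ => Q ζ - Q' ζ) = contour L θ Q - contour L θ Q' := by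
  have h1 := abs_of_pos hθ
  have h2 : |-θ| = θ := by rw [abs_neg, abs_of_pos hθ]
  simp only [contour]
  rw [integral_sub (h θ h1) (h' θ h1), integral_sub (h (-θ) h2) (h' (-θ) h2),
    intervalIntegral.integral_sub hs hs']
  ring

theorem contour_const_mul (L θ : ℝ) (c : ℂ) (Q : ℂ → ℂ) :
    contour L θ (fun ζ => c * Q ζ) = c * contour L θ Q := by
  simp only [contour, integral_const_mul, intervalIntegral.integral_const_mul]
  ring

theorem re_exp_ray {θ η s : ℝ} (hη : |η| = θ) :
    (Complex.exp (s + η * Complex.I)).re = Real.exp s * Real.cos θ := by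
  rw [Complex.exp_re, ← hη, Real.cos_abs]
  simp

theorem norm_sub_exp_ray {θ η s x : ℝ} (hη : |η| = θ) (hx : 0 ≤ x) :
    -Real.cos θ * Real.exp s ≤ ‖(x : ℂ) - Complex.exp (s + η * Complex.I)‖ := by
  calc -Real.cos θ * Real.exp s ≤ ((x : ℂ) - Complex.exp (s + η * Complex.I)).re := by
        rw [Complex.sub_re, re_exp_ray hη, Complex.ofReal_re]; linarith
    _ ≤ _ := Complex.re_le_norm _

theorem cos_neg_of_mem {θ : ℝ} (hθ : θ ∈ Ioo (Real.pi / 2) Real.pi) : Real.cos θ < 0 :=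
  Real.cos_neg_of_pi_div_two_lt_of_lt hθ.1 (by linarith [hθ.2, Real.pi_pos])

/-- On the boundary of the half-strip, `exp ζ` avoids the real half-line beyond `exp L`. -/
theorem sub_exp_mem_slitPlane {L θ x : ℝ} (hθ : θ ∈ Ioo (Real.pi / 2) Real.pi)
    (hx : Real.exp L < x) {ζ : ℂ} (h : ζ.re = L ∨ |ζ.im| = θ) :
    (x : ℂ) - Complex.exp ζ ∈ Complex.slitPlane := by
  left
  have hx0 := (Real.exp_pos L).trans hx
  rcases h with h | h
  · have h1 : (Complex.exp ζ).re ≤ Real.exp L := by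
      rw [← h, ← Complex.norm_exp]; exact Complex.re_le_norm _
    simp; linarith
  · have h1 := re_exp_ray (s := ζ.re) h
    rw [Complex.re_add_im] at h1
    simp only [Complex.sub_re, Complex.ofReal_re, h1]
    nlinarith [Real.exp_pos ζ.re, cos_neg_of_mem hθ]

/-- The integrand has the primitive `ζ - log (x - exp ζ)`, with principal logarithm, since `x - exp
ζ` has positive real part along the contour. The corner values cancel, and the limits `±π i` at the
two infinite ends leave `2 π i`. -/
theorem contour_inv_sub_exp {L θ x : ℝ} (hθ : θ ∈ Ioo (Real.pi / 2) Real.pi)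
    (hx : Real.exp L < x) :
    contour L θ (fun ζ => x / (x - Complex.exp ζ)) = 2 * Real.pi * Complex.I := by
  have hx0 := (Real.exp_pos L).trans hx
  have hθ0 : 0 < θ := by linarith [hθ.1, Real.pi_pos]
  have hcos := cos_neg_of_mem hθ
  set P : ℂ → ℂ := fun ζ => ζ - Complex.log (x - Complex.exp ζ) with hP
  have hderiv : ∀ ζ : ℂ, (ζ.re = L ∨ |ζ.im| = θ) →
      HasDerivAt P (x / (x - Complex.exp ζ)) ζ := by
    intro ζ hζ
    have hs := sub_exp_mem_slitPlane hθ hx hζ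
    have h1 : HasDerivAt (fun ζ => (x : ℂ) - Complex.exp ζ) (-Complex.exp ζ) ζ :=
      (Complex.hasDerivAt_exp ζ).const_sub _
    have h2 : (x : ℂ) / (x - Complex.exp ζ) = 1 - -Complex.exp ζ / (x - Complex.exp ζ) := by
      rw [eq_sub_iff_add_eq, ← add_div, ← sub_eq_add_neg,
        div_self (Complex.slitPlane_ne_zero hs)]
    rw [h2]
    exact (hasDerivAt_id ζ).sub (h1.clog hs)
  have hray : ∀ η : ℝ, |η| = θ → ∀ m : ℂ,
      Tendsto (fun s : ℝ => P (s + η * Complex.I)) atTop (𝓝 m) →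
      ∫ s in Ioi L, (fun ζ : ℂ => (x : ℂ) / (x - Complex.exp ζ)) (s + η * Complex.I) =
        m - P (L + η * Complex.I) := by
    intro η hη m hm
    have hd : ∀ s : ℝ, HasDerivAt (fun s : ℝ => P (s + η * Complex.I))
        (x / (x - Complex.exp (s + η * Complex.I))) s := by
      intro s
      have h1 := hderiv (s + η * Complex.I) (Or.inr (by simp [hη]))
      have h2 : HasDerivAt (fun s : ℝ => (s : ℂ) + η * Complex.I) 1 s :=
        (Complex.ofRealCLM.hasDerivAt (x := s)).add_const _
      simpa using! h1.comp s h2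
    refine integral_Ioi_of_hasDerivAt_of_tendsto (hd L).continuousAt.continuousWithinAt
      (fun s _ => hd s) ?_ hm
    refine integrableOn_ray (Q := fun ζ : ℂ => (x : ℂ) / (x - Complex.exp ζ))
      (C := x / (-Real.cos θ)) ?_ ?_
    · intro s _
      refine ContinuousAt.div continuousAt_const (by fun_prop)
        (Complex.slitPlane_ne_zero (sub_exp_mem_slitPlane hθ hx (Or.inr (by simp [hη]))))
    · intro s _
      rw [norm_div, Complex.norm_real, Real.norm_of_nonneg hx0.le, Real.exp_neg,
        ← div_eq_mul_inv, div_div]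
      have hpos : 0 < -Real.cos θ * Real.exp s := mul_pos (by linarith) (Real.exp_pos s)
      gcongr
      exact norm_sub_exp_ray hη hx0.le
  have hlim : ∀ η : ℝ, |η| = θ → Tendsto (fun s : ℝ => P (s + η * Complex.I)) atTop
      (𝓝 (η * Complex.I - Complex.log (-Complex.exp (η * Complex.I)))) := by
    intro η hη
    have hmem : -Complex.exp (η * Complex.I) ∈ Complex.slitPlane := by
      left
      rw [Complex.neg_re, Complex.exp_ofReal_mul_I_re, ← Real.cos_abs, hη]
      linarith
    have h1 : Tendsto (fun s : ℝ => ((x * Real.exp (-s) : ℝ) : ℂ) - Complex.exp (η * Complex.I))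
        atTop (𝓝 (((x * 0 : ℝ) : ℂ) - Complex.exp (η * Complex.I))) :=
      ((Complex.continuous_ofReal.tendsto _).comp
        (Real.tendsto_exp_neg_atTop_nhds_zero.const_mul x)).sub_const _
    rw [mul_zero, Complex.ofReal_zero, zero_sub] at h1
    have h2 := (h1.clog hmem).const_sub (η * Complex.I)
    refine h2.congr fun s => ?_
    have h3 : (x : ℂ) - Complex.exp (s + η * Complex.I) = (Real.exp s : ℝ) *
        (((x * Real.exp (-s) : ℝ) : ℂ) - Complex.exp (η * Complex.I)) := by
      rw [mul_sub, ← Complex.ofReal_mul, mul_left_comm, ← Real.exp_add, add_neg_cancel,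
        Real.exp_zero, mul_one, Complex.exp_add, Complex.ofReal_exp]
    have h4 : ((x * Real.exp (-s) : ℝ) : ℂ) - Complex.exp (η * Complex.I) ≠ 0 := by
      intro h0
      rw [h0, mul_zero] at h3
      exact Complex.slitPlane_ne_zero (sub_exp_mem_slitPlane hθ hx (L := L)
        (ζ := s + η * Complex.I) (Or.inr (by simp [hη]))) h3
    simp only [hP]
    rw [h3, Complex.log_ofReal_mul (Real.exp_pos s) h4, Real.log_exp]
    ring
  have htop : θ * Complex.I - Complex.log (-Complex.exp (θ * Complex.I)) = Real.pi * Complex.I := by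
    have h1 : -Complex.exp (θ * Complex.I) = Complex.exp (((θ - Real.pi : ℝ) : ℂ) * Complex.I) := by
      push_cast
      rw [sub_mul, Complex.exp_sub, Complex.exp_pi_mul_I]; ring
    rw [h1, Complex.log_exp (by simp; linarith) (by simp; linarith [hθ.2, Real.pi_pos])]
    push_cast; ring
  have hbot : (-θ : ℝ) * Complex.I - Complex.log (-Complex.exp ((-θ : ℝ) * Complex.I))
      = -(Real.pi * Complex.I) := by
    have h1 : -Complex.exp ((-θ : ℝ) * Complex.I) =
        Complex.exp (((-θ + Real.pi : ℝ) : ℂ) * Complex.I) := by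
      push_cast
      rw [add_mul, Complex.exp_add, Complex.exp_pi_mul_I]; ring
    rw [h1, Complex.log_exp (by simp; linarith [hθ.2, Real.pi_pos]) (by simp; linarith)]
    push_cast; ring
  have hseg : Complex.I * ∫ φ in (-θ)..θ,
      (fun ζ : ℂ => (x : ℂ) / (x - Complex.exp ζ)) (L + φ * Complex.I) =
      P (L + θ * Complex.I) - P (L + (-θ : ℝ) * Complex.I) := by
    rw [← intervalIntegral.integral_const_mul]
    refine intervalIntegral.integral_eq_sub_of_hasDerivAt
      (f := fun φ : ℝ => P (L + φ * Complex.I)) ?_ ?_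
    · intro φ _
      have h1 := hderiv (L + φ * Complex.I) (Or.inl (by simp))
      have h2 : HasDerivAt (fun φ : ℝ => (L : ℂ) + φ * Complex.I) Complex.I φ := by
        simpa using ((Complex.ofRealCLM.hasDerivAt (x := φ)).mul_const Complex.I).const_add (L : ℂ)
      simpa [mul_comm] using! h1.comp φ h2
    · refine Continuous.intervalIntegrable ?_ _ _
      refine continuous_const.mul (Continuous.div continuous_const (by fun_prop) fun φ => ?_)
      exact Complex.slitPlane_ne_zero (sub_exp_mem_slitPlane hθ hx (L := L) (Or.inl (by simp)))
  rw [contour, hray θ (abs_of_pos hθ0) _ (hlim θ (abs_of_pos hθ0)),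
    hray (-θ) (by rw [abs_neg, abs_of_pos hθ0]) _ (hlim (-θ) (by rw [abs_neg, abs_of_pos hθ0])),
    hseg, htop, hbot]
  ring

/-- Cauchy's formula on the half-strip in the variable `z = exp ζ`. -/
theorem contour_cauchy {L θ x K : ℝ} (hθ : θ ∈ Ioo (Real.pi / 2) Real.pi)
    (hx : Real.exp L < x) {Φ : ℂ → ℂ} (hd : ∀ ζ : ℂ, L ≤ ζ.re → DifferentiableAt ℂ Φ ζ)
    (hK : ∀ ζ : ℂ, L ≤ ζ.re → ‖Φ ζ‖ ≤ K * Real.exp (-ζ.re)) :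
    contour L θ (fun ζ => Complex.exp ζ * Φ ζ / (x - Complex.exp ζ)) =
      2 * Real.pi * Complex.I * Φ (Real.log x) := by
  have hx0 := (Real.exp_pos L).trans hx
  have hθ0 : 0 < θ := by linarith [hθ.1, Real.pi_pos]
  have hcos := cos_neg_of_mem hθ
  set l : ℂ := ((Real.log x : ℝ) : ℂ) with hl
  have hL : L < Real.log x := (Real.lt_log_iff_exp_lt hx0).2 hx
  have hexpl : Complex.exp l = x := by rw [hl, ← Complex.ofReal_exp, Real.exp_log hx0]
  set N : ℂ → ℂ := fun ζ => Complex.exp ζ * Φ ζ - x * Φ l with hN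
  have hNl : N l = 0 := by simp [hN, hexpl]
  have hNd : ∀ ζ : ℂ, L ≤ ζ.re → DifferentiableAt ℂ N ζ := fun ζ hζ =>
    (Complex.differentiable_exp.differentiableAt.mul (hd ζ hζ)).sub_const _
  have hNb : ∀ ζ : ℂ, L ≤ ζ.re → ‖N ζ‖ ≤ K + x * ‖Φ l‖ := by
    intro ζ hζ
    refine (norm_sub_le _ _).trans (add_le_add ?_ ?_)
    · rw [norm_mul, Complex.norm_exp]
      calc Real.exp ζ.re * ‖Φ ζ‖ ≤ Real.exp ζ.re * (K * Real.exp (-ζ.re)) := by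
            gcongr; exact hK ζ hζ
        _ = K := by rw [mul_left_comm, ← Real.exp_add]; simp
    · rw [norm_mul, Complex.norm_real, Real.norm_of_nonneg hx0.le]
  have hD0 : 0 ≤ K + x * ‖Φ l‖ := (norm_nonneg _).trans (hNb l (by simp [hl, hL.le]))
  -- Away from `l = log x` this is `N / (exp ζ - x)`. The quotient of divided differences removes
  -- the singularity: `Q` is continuous at `l`, and `contour_eq_zero` tolerates one point without
  -- differentiability.
  set Q : ℂ → ℂ := fun ζ => dslope N l ζ / dslope Complex.exp l ζ with hQ
  have hQne : ∀ ζ, ζ ≠ l → Q ζ = N ζ / (Complex.exp ζ - x) := by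
    intro ζ hζ
    simp only [hQ]
    rw [dslope_of_ne _ hζ, dslope_of_ne _ hζ, slope_def_field, slope_def_field, hNl, hexpl,
      sub_zero, div_div_div_cancel_right₀ (sub_ne_zero.2 hζ)]
  -- Here `θ < π` matters: `exp` is injective on the closed strip, so `l` is the only zero of `exp ζ
  -- - x` there.
  have hexpne : ∀ ζ : ℂ, |ζ.im| ≤ θ → ζ ≠ l → Complex.exp ζ ≠ x := by
    intro ζ hζ hne h
    apply hne
    have h1 := congrArg Complex.log h
    rw [Complex.log_exp (by linarith [(abs_le.1 hζ).1, hθ.2])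
      (by linarith [(abs_le.1 hζ).2, hθ.2])] at h1
    rw [h1, hl, Complex.ofReal_log hx0.le]
  have hden : ∀ ζ : ℂ, |ζ.im| ≤ θ → dslope Complex.exp l ζ ≠ 0 := by
    intro ζ hζ
    by_cases h : ζ = l
    · rw [h, dslope_same, Complex.deriv_exp]; exact Complex.exp_ne_zero _
    · rw [dslope_of_ne _ h, slope_def_field, hexpl]
      exact div_ne_zero (sub_ne_zero.2 (hexpne ζ hζ h)) (sub_ne_zero.2 h)
  have hQc : ∀ ζ : ℂ, L ≤ ζ.re → |ζ.im| ≤ θ → ContinuousAt Q ζ := by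
    intro ζ hre him
    refine ContinuousAt.div ?_ ?_ (hden ζ him)
    · by_cases h : ζ = l
      · rw [h]; exact continuousAt_dslope_same.2 (hNd l (by simp [hl, hL.le]))
      · exact (continuousAt_dslope_of_ne h).2 (hNd ζ hre).continuousAt
    · by_cases h : ζ = l
      · rw [h]; exact continuousAt_dslope_same.2 Complex.differentiable_exp.differentiableAt
      · exact (continuousAt_dslope_of_ne h).2 Complex.continuous_exp.continuousAt
  have hQd : ∀ ζ : ℂ, L ≤ ζ.re → |ζ.im| ≤ θ → ζ ∉ ({l} : Set ℂ) → DifferentiableAt ℂ Q ζ := by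
    intro ζ hre him hne
    have hne' : ζ ≠ l := hne
    exact ((differentiableAt_dslope_of_ne hne').2 (hNd ζ hre)).div
      ((differentiableAt_dslope_of_ne hne').2 Complex.differentiable_exp.differentiableAt)
      (hden ζ him)
  have hray_ne : ∀ (s η : ℝ), |η| = θ → (s : ℂ) + η * Complex.I ≠ l := by
    intro s η hη h
    have := congrArg Complex.im h
    simp [hl] at this
    rw [this] at hη
    simp at hη
    linarith
  have hQi : ∀ η : ℝ, |η| = θ → IntegrableOn (fun s : ℝ => Q (s + η * Complex.I)) (Ioi L) := by
    intro η hη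
    refine integrableOn_ray (C := (K + x * ‖Φ l‖) / (-Real.cos θ))
      (fun s hs => hQc _ (by simpa using hs) (by simp [hη])) fun s hs => ?_
    rw [hQne _ (hray_ne s η hη), norm_div, norm_sub_rev _ (x : ℂ), Real.exp_neg, ← div_eq_mul_inv, div_div]
    have hpos : 0 < -Real.cos θ * Real.exp s := mul_pos (by linarith) (Real.exp_pos s)
    exact div_le_div₀ hD0 (hNb _ (by simpa using hs)) hpos (norm_sub_exp_ray hη hx0.le)
  have hQ0 : contour L θ Q = 0 := by
    refine contour_eq_zero (C := 2 * (K + x * ‖Φ l‖)) (b₀ := max L (Real.log (2 * x))) hθ0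
      (countable_singleton l) hQc hQd (fun ζ hre him => ?_) hQi
    have h1 : Real.log (2 * x) ≤ ζ.re := (le_max_right _ _).trans hre
    have h2 : 2 * x ≤ Real.exp ζ.re := (Real.log_le_iff_le_exp (by linarith)).1 h1
    have hne : ζ ≠ l := by
      intro h
      rw [h, hl, Complex.ofReal_re, Real.exp_log hx0] at h2
      linarith
    have h3 : Real.exp ζ.re / 2 ≤ ‖Complex.exp ζ - x‖ := by
      have := norm_sub_norm_le (Complex.exp ζ) (x : ℂ)
      rw [Complex.norm_exp, Complex.norm_real, Real.norm_of_nonneg hx0.le] at this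
      linarith
    rw [hQne ζ hne, norm_div]
    calc _ ≤ (K + x * ‖Φ l‖) / (Real.exp ζ.re / 2) :=
          div_le_div₀ hD0 (hNb ζ ((le_max_left _ _).trans hre)) (by positivity) h3
      _ = _ := by rw [Real.exp_neg]; field_simp
  have hcongr : contour L θ (fun ζ => Complex.exp ζ * Φ ζ / (x - Complex.exp ζ)) =
      contour L θ (fun ζ => Φ l * (x / (x - Complex.exp ζ)) - Q ζ) := by
    refine contour_congr hθ0 fun ζ hre him hb => ?_
    have hne : ζ ≠ l := by
      intro h
      rcases hb with hb | hb
      · rw [h] at hb; simp [hl] at hb; linarith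
      · rw [h] at hb; simp [hl] at hb; linarith
    rw [hQne ζ hne]
    have h1 := Complex.slitPlane_ne_zero (sub_exp_mem_slitPlane hθ hx hb)
    rw [← neg_sub (x : ℂ), div_neg, hN]
    field_simp
    ring
  have hAi : ∀ η : ℝ, |η| = θ → IntegrableOn (fun s : ℝ =>
      (fun ζ => Φ l * (x / (x - Complex.exp ζ))) (s + η * Complex.I)) (Ioi L) := by
    intro η hη
    refine integrableOn_ray (Q := fun ζ => Φ l * (x / (x - Complex.exp ζ)))
      (C := ‖Φ l‖ * (x / (-Real.cos θ))) (fun s hs => ?_) fun s hs => ?_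
    · refine continuousAt_const.mul (ContinuousAt.div continuousAt_const (by fun_prop)
        (Complex.slitPlane_ne_zero (sub_exp_mem_slitPlane hθ hx (Or.inr (by simp [hη])))))
    · have hpos : 0 < -Real.cos θ * Real.exp s := mul_pos (by linarith) (Real.exp_pos s)
      rw [norm_mul, norm_div, Complex.norm_real, Real.norm_of_nonneg hx0.le, mul_assoc,
        Real.exp_neg, ← div_eq_mul_inv, div_div]
      gcongr
      exact norm_sub_exp_ray hη hx0.le
  have hAs : IntervalIntegrable (fun φ : ℝ =>
      (fun ζ => Φ l * (x / (x - Complex.exp ζ))) (L + φ * Complex.I)) volume (-θ) θ := by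
    refine Continuous.intervalIntegrable ?_ _ _
    refine continuous_const.mul (Continuous.div continuous_const (by fun_prop) fun φ => ?_)
    exact Complex.slitPlane_ne_zero (sub_exp_mem_slitPlane hθ hx (L := L) (Or.inl (by simp)))
  have hQs : IntervalIntegrable (fun φ : ℝ => Q (L + φ * Complex.I)) volume (-θ) θ := by
    refine ContinuousOn.intervalIntegrable fun φ hφ => ?_
    rw [uIcc_of_le (by linarith)] at hφ
    exact ((hQc (L + φ * Complex.I) (by simp) (by simpa using abs_le.2 hφ)).comp
      (f := fun φ : ℝ => (L : ℂ) + φ * Complex.I) (by fun_prop)).continuousWithinAt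
  rw [hcongr, contour_sub hθ0 hAi hQi hAs hQs, contour_const_mul, hQ0, sub_zero,
    contour_inv_sub_exp hθ hx]
  ring

/-! ### The inverse Laplace transform along the Hankel-type contour -/

/-- The inverse Laplace transform of `z ↦ Φ (log z)` along the Hankel-type contour. -/
def inverseLaplace (L θ : ℝ) (Φ : ℂ → ℂ) (t : ℝ) : ℂ :=
  (2 * Real.pi * Complex.I)⁻¹ *
    contour L θ (fun ζ => Complex.exp (t * Complex.exp ζ) * (Complex.exp ζ * Φ ζ))

theorem norm_combination_sub_le (a₁ a₂ a₃ b₁ b₂ b₃ : ℂ) :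
    ‖(a₁ - a₂ + Complex.I * a₃) - (b₁ - b₂ + Complex.I * b₃)‖ ≤
      ‖a₁ - b₁‖ + ‖a₂ - b₂‖ + ‖a₃ - b₃‖ := by
  rw [show (a₁ - a₂ + Complex.I * a₃) - (b₁ - b₂ + Complex.I * b₃) =
    (a₁ - b₁) - (a₂ - b₂) + Complex.I * (a₃ - b₃) by ring]
  refine (norm_add_le _ _).trans (add_le_add (norm_sub_le _ _) (le_of_eq ?_))
  rw [norm_mul, Complex.norm_I, one_mul]

theorem norm_exp_mul_le {L K : ℝ} {Φ : ℂ → ℂ}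
    (hK : ∀ ζ : ℂ, L ≤ ζ.re → ‖Φ ζ‖ ≤ K * Real.exp (-ζ.re)) {ζ : ℂ} (hζ : L ≤ ζ.re) :
    ‖Complex.exp ζ * Φ ζ‖ ≤ K := by
  rw [norm_mul, Complex.norm_exp]
  calc Real.exp ζ.re * ‖Φ ζ‖ ≤ Real.exp ζ.re * (K * Real.exp (-ζ.re)) := by
        gcongr; exact hK ζ hζ
    _ = K := by rw [mul_left_comm, ← Real.exp_add]; simp

/-- Each of the three pieces of the contour is a superposition of exponentials with `Re z ≤ exp L`,
so `laplace_superposition` applies to each. The main terms recombine into the contour integral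
evaluated by `contour_cauchy`. -/
theorem laplace_inverseLaplace {L θ K T : ℝ} (hθ : θ ∈ Ioo (Real.pi / 2) Real.pi) (hT : 0 < T)
    {Φ : ℂ → ℂ} (hd : ∀ ζ : ℂ, L ≤ ζ.re → DifferentiableAt ℂ Φ ζ)
    (hK : ∀ ζ : ℂ, L ≤ ζ.re → ‖Φ ζ‖ ≤ K * Real.exp (-ζ.re)) :
    IntegrableOn (inverseLaplace L θ Φ) (Ioc 0 T) ∧
    ∃ C, ∀ x, Real.exp L + 1 ≤ x →
      ‖(∫ t in Ioc 0 T, ((Real.exp (-(x * t)) : ℝ) : ℂ) * inverseLaplace L θ Φ t) -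
        Φ (Real.log x)‖ ≤ C * Real.exp (-(x * T)) := by
  have hθ0 : 0 < θ := by linarith [hθ.1, Real.pi_pos]
  have hcos := cos_neg_of_mem hθ
  set x₀ := Real.exp L + 1 with hx₀
  have hK0 : 0 ≤ K := (norm_nonneg _).trans (norm_exp_mul_le hK (ζ := L) (by simp))
  have hray : ∀ η : ℝ, |η| = θ → Integrable (fun s : ℝ =>
      Complex.exp (s + η * Complex.I) * Φ (s + η * Complex.I) /
        ((x₀ - (Complex.exp (s + η * Complex.I)).re : ℝ) : ℂ)) (volume.restrict (Ioi L)) := by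
    intro η hη
    have hpos : ∀ s : ℝ, -Real.cos θ * Real.exp s ≤ x₀ - (Complex.exp (s + η * Complex.I)).re := by
      intro s
      rw [re_exp_ray hη]
      linarith [Real.exp_pos L]
    have hpos' : ∀ s : ℝ, 0 < -Real.cos θ * Real.exp s := fun s =>
      mul_pos (by linarith) (Real.exp_pos s)
    refine integrableOn_ray (C := K / (-Real.cos θ))
      (Q := fun ζ => Complex.exp ζ * Φ ζ / ((x₀ - (Complex.exp ζ).re : ℝ) : ℂ)) ?_ ?_
    · intro s hs
      have h1 := (hd (s + η * Complex.I) (by simpa using hs)).continuousAt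
      refine ContinuousAt.div (by fun_prop) ?_
        (Complex.ofReal_ne_zero.2 ((hpos' s).trans_le (hpos s)).ne')
      exact Complex.continuous_ofReal.continuousAt.comp
        (continuousAt_const.sub (Complex.continuous_re.comp Complex.continuous_exp).continuousAt)
    · intro s hs
      rw [norm_div, Complex.norm_real, Real.norm_of_nonneg ((hpos' s).trans_le (hpos s)).le,
        Real.exp_neg, ← div_eq_mul_inv, div_div]
      exact div_le_div₀ hK0 (norm_exp_mul_le hK (by simpa using hs)) (hpos' s) (hpos s)
  have hseg : Integrable (fun φ : ℝ =>
      Complex.exp (L + φ * Complex.I) * Φ (L + φ * Complex.I) /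
        ((x₀ - (Complex.exp (L + φ * Complex.I)).re : ℝ) : ℂ)) (volume.restrict (Ioc (-θ) θ)) := by
    refine (Continuous.integrableOn_Icc ?_).mono_set Ioc_subset_Icc_self
    refine Continuous.div ?_ (by fun_prop) fun φ => Complex.ofReal_ne_zero.2 ?_
    · refine Continuous.mul (by fun_prop) (continuous_iff_continuousAt.2 fun φ => ?_)
      exact (hd (L + φ * Complex.I) (by simp)).continuousAt.comp
        (f := fun φ : ℝ => (L : ℂ) + φ * Complex.I) (by fun_prop)
    · have h1 : (Complex.exp (L + φ * Complex.I)).re ≤ Real.exp L := by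
        refine (Complex.re_le_norm _).trans (le_of_eq ?_)
        rw [Complex.norm_exp]; simp
      linarith
  have hrayM : ∀ η : ℝ, |η| = θ → ∀ s : ℝ, (Complex.exp (s + η * Complex.I)).re ≤ Real.exp L := by
    intro η hη s
    rw [re_exp_ray hη]
    nlinarith [Real.exp_pos L, Real.exp_pos s]
  have hsegM : ∀ φ : ℝ, (Complex.exp (L + φ * Complex.I)).re ≤ Real.exp L := by
    intro φ
    refine (Complex.re_le_norm _).trans (le_of_eq ?_)
    rw [Complex.norm_exp]; simp
  have habs := abs_of_pos hθ0
  have habs' : |-θ| = θ := by rw [abs_neg, abs_of_pos hθ0]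
  obtain ⟨hi1, C1, hC1⟩ := laplace_superposition (by fun_prop) hT (hrayM θ habs)
    (show Real.exp L < x₀ by simp [hx₀]) (hray θ habs)
  obtain ⟨hi2, C2, hC2⟩ := laplace_superposition (by fun_prop) hT (hrayM (-θ) habs')
    (show Real.exp L < x₀ by simp [hx₀]) (hray (-θ) habs')
  obtain ⟨hi3, C3, hC3⟩ := laplace_superposition (by fun_prop) hT hsegM
    (show Real.exp L < x₀ by simp [hx₀]) hseg
  set V1 : ℝ → ℂ := fun t => ∫ s in Ioi L, Complex.exp (t * Complex.exp (s + θ * Complex.I)) *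
    (Complex.exp (s + θ * Complex.I) * Φ (s + θ * Complex.I))
  set V2 : ℝ → ℂ := fun t => ∫ s in Ioi L, Complex.exp (t * Complex.exp (s + (-θ : ℝ) * Complex.I)) *
    (Complex.exp (s + (-θ : ℝ) * Complex.I) * Φ (s + (-θ : ℝ) * Complex.I))
  set V3 : ℝ → ℂ := fun t => ∫ φ in Ioc (-θ) θ, Complex.exp (t * Complex.exp (L + φ * Complex.I)) *
    (Complex.exp (L + φ * Complex.I) * Φ (L + φ * Complex.I))
  have hV : ∀ t, inverseLaplace L θ Φ t =
      (2 * Real.pi * Complex.I)⁻¹ * (V1 t - V2 t + Complex.I * V3 t) := by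
    intro t
    rw [inverseLaplace, contour, intervalIntegral.integral_of_le (by linarith)]
  have hVi : IntegrableOn (fun t => V1 t - V2 t + Complex.I * V3 t) (Ioc 0 T) :=
    (hi1.sub hi2).add (hi3.const_mul Complex.I)
  refine ⟨(hVi.const_mul (2 * Real.pi * Complex.I)⁻¹).congr
    (Eventually.of_forall fun t => (hV t).symm),
    ‖(2 * Real.pi * Complex.I : ℂ)⁻¹‖ * (C1 + C2 + C3), fun x hx => ?_⟩
  have hsum : ∫ t in Ioc 0 T, ((Real.exp (-(x * t)) : ℝ) : ℂ) * inverseLaplace L θ Φ t =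
      (2 * Real.pi * Complex.I)⁻¹ * ((∫ t in Ioc 0 T, ((Real.exp (-(x * t)) : ℝ) : ℂ) * V1 t) -
        (∫ t in Ioc 0 T, ((Real.exp (-(x * t)) : ℝ) : ℂ) * V2 t) +
        Complex.I * ∫ t in Ioc 0 T, ((Real.exp (-(x * t)) : ℝ) : ℂ) * V3 t) := by
    rw [← integral_const_mul Complex.I, ← integral_sub (integrableOn_exp_mul hi1 x) (integrableOn_exp_mul hi2 x),
      ← integral_add (f := fun t => ((Real.exp (-(x * t)) : ℝ) : ℂ) * V1 t -
        ((Real.exp (-(x * t)) : ℝ) : ℂ) * V2 t)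
        ((integrableOn_exp_mul hi1 x).sub (integrableOn_exp_mul hi2 x)) ((integrableOn_exp_mul hi3 x).const_mul Complex.I),
      ← integral_const_mul]
    congr 1
    ext t
    rw [hV]
    ring
  have hcauchy := contour_cauchy hθ (show Real.exp L < x by linarith) hd hK
  rw [contour, intervalIntegral.integral_of_le (by linarith)] at hcauchy
  have hΦ : Φ (Real.log x) = (2 * Real.pi * Complex.I)⁻¹ *
      (2 * Real.pi * Complex.I * Φ (Real.log x)) := by
    rw [← mul_assoc, inv_mul_cancel₀ Complex.two_pi_I_ne_zero, one_mul]
  rw [hsum, hΦ, ← hcauchy, ← mul_sub, norm_mul, mul_assoc ‖_‖]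
  refine mul_le_mul_of_nonneg_left ?_ (norm_nonneg _)
  rw [add_mul, add_mul]
  exact (norm_combination_sub_le _ _ _ _ _ _).trans
    (add_le_add (add_le_add (hC1 x hx) (hC2 x hx)) (hC3 x hx))

/-- On a ray, `|exp (t exp ζ)| = exp (-u)` with `u` a positive multiple of `exp s`. The crude bound
`exp (-u) ≤ 2 / u ^ 2` already beats growth of order `exp s`, the worst case after one time
derivative. -/
theorem integrableOn_ray_exp {L θ η K t : ℝ} (hθ : θ ∈ Ioo (Real.pi / 2) Real.pi) (hη : |η| = θ)
    (ht : 0 < t) {Ψ : ℂ → ℂ} (hc : ∀ ζ : ℂ, L ≤ ζ.re → ContinuousAt Ψ ζ)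
    (hK : ∀ ζ : ℂ, L ≤ ζ.re → ‖Ψ ζ‖ ≤ K * Real.exp ζ.re) :
    IntegrableOn (fun s : ℝ => Complex.exp (t * Complex.exp (s + η * Complex.I)) *
      Ψ (s + η * Complex.I)) (Ioi L) := by
  have hcos := cos_neg_of_mem hθ
  refine integrableOn_ray (Q := fun ζ => Complex.exp (t * Complex.exp ζ) * Ψ ζ)
    (C := 2 * K / (t * Real.cos θ) ^ 2) (fun s hs => ?_) fun s hs => ?_
  · have := hc (s + η * Complex.I) (by simpa using hs)
    fun_prop
  · have h1 := hK (s + η * Complex.I) (by simpa using hs)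
    have hre : ((s : ℂ) + η * Complex.I).re = s := by simp
    rw [hre] at h1
    have hK0 : 0 ≤ K := by
      have := (norm_nonneg _).trans h1
      exact nonneg_of_mul_nonneg_left this (Real.exp_pos s)
    rw [norm_mul, Complex.norm_exp, Complex.re_ofReal_mul, re_exp_ray hη]
    set u := -(t * Real.cos θ) * Real.exp s with hu
    have hu0 : 0 < u := mul_pos (by nlinarith) (Real.exp_pos s)
    have h2 : t * (Real.exp s * Real.cos θ) = -u := by rw [hu]; ring
    have h3 : Real.exp (-u) ≤ 2 / u ^ 2 := by
      rw [Real.exp_neg, ← one_div, div_le_div_iff₀ (Real.exp_pos u) (by positivity)]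
      nlinarith [Real.quadratic_le_exp_of_nonneg hu0.le]
    rw [h2]
    calc _ ≤ 2 / u ^ 2 * (K * Real.exp s) := by gcongr
      _ = _ := by
        rw [hu, Real.exp_neg]
        have : t * Real.cos θ ≠ 0 := by nlinarith
        field_simp

theorem hasDerivAt_inverseLaplace {L θ K t : ℝ} (hθ : θ ∈ Ioo (Real.pi / 2) Real.pi) (ht : 0 < t)
    {Φ : ℂ → ℂ} (hd : ∀ ζ : ℂ, L ≤ ζ.re → DifferentiableAt ℂ Φ ζ)
    (hK : ∀ ζ : ℂ, L ≤ ζ.re → ‖Φ ζ‖ ≤ K * Real.exp (-ζ.re)) :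
    HasDerivAt (inverseLaplace L θ Φ) (inverseLaplace L θ (fun ζ => Complex.exp ζ * Φ ζ) t) t := by
  have hθ0 : 0 < θ := by linarith [hθ.1, Real.pi_pos]
  have habs := abs_of_pos hθ0
  have habs' : |-θ| = θ := by rw [abs_neg, abs_of_pos hθ0]
  have hK0 : 0 ≤ K := (norm_nonneg _).trans (norm_exp_mul_le hK (ζ := L) (by simp))
  have hΦc : ∀ ζ : ℂ, L ≤ ζ.re → ContinuousAt Φ ζ := fun ζ hζ => (hd ζ hζ).continuousAt
  have hray : ∀ η : ℝ, |η| = θ → HasDerivAt (fun t : ℝ => ∫ s in Ioi L,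
      Complex.exp (t * Complex.exp (s + η * Complex.I)) *
        (Complex.exp (s + η * Complex.I) * Φ (s + η * Complex.I)))
      (∫ s in Ioi L, Complex.exp (t * Complex.exp (s + η * Complex.I)) *
        (Complex.exp (s + η * Complex.I) *
          (Complex.exp (s + η * Complex.I) * Φ (s + η * Complex.I)))) t := by
    intro η hη
    refine hasDerivAt_superposition (by fun_prop) ?_ (fun t ht => ?_) (fun t ht => ?_) ht
    · refine ContinuousOn.aestronglyMeasurable (fun s hs => ?_) measurableSet_Ioi
      have h1 := hΦc (s + η * Complex.I) (by simpa using le_of_lt hs)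
      refine (ContinuousAt.mul (by fun_prop) ?_).continuousWithinAt
      exact h1.comp (f := fun s : ℝ => (s : ℂ) + η * Complex.I) (by fun_prop)
    · refine integrableOn_ray_exp (Ψ := fun ζ => Complex.exp ζ * Φ ζ) (K := K * Real.exp (-L))
        hθ hη ht (fun ζ hζ => ?_) fun ζ hζ => ?_
      · have := hΦc ζ hζ
        fun_prop
      · refine (norm_exp_mul_le hK hζ).trans ?_
        rw [mul_assoc, ← Real.exp_add]
        exact le_mul_of_one_le_right hK0 (Real.one_le_exp (by linarith))
    · refine integrableOn_ray_exp (Ψ := fun ζ => Complex.exp ζ * (Complex.exp ζ * Φ ζ)) (K := K)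
        hθ hη ht (fun ζ hζ => ?_) fun ζ hζ => ?_
      · have := hΦc ζ hζ
        fun_prop
      · rw [norm_mul, Complex.norm_exp, mul_comm]
        gcongr
        exact norm_exp_mul_le hK hζ
  have hsegc : Continuous fun φ : ℝ => Φ (L + φ * Complex.I) :=
    continuous_iff_continuousAt.2 fun φ => (hΦc (L + φ * Complex.I) (by simp)).comp
      (f := fun φ : ℝ => (L : ℂ) + φ * Complex.I) (by fun_prop)
  have hexpc : Continuous fun φ : ℝ => Complex.exp (L + φ * Complex.I) := by fun_prop
  have hsegc' := hexpc.mul hsegc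
  have hexpt : ∀ t : ℝ, Continuous fun φ : ℝ =>
      Complex.exp (t * Complex.exp (L + φ * Complex.I)) := fun t => by fun_prop
  have hseg : HasDerivAt (fun t : ℝ => ∫ φ in Ioc (-θ) θ,
      Complex.exp (t * Complex.exp (L + φ * Complex.I)) *
        (Complex.exp (L + φ * Complex.I) * Φ (L + φ * Complex.I)))
      (∫ φ in Ioc (-θ) θ, Complex.exp (t * Complex.exp (L + φ * Complex.I)) *
        (Complex.exp (L + φ * Complex.I) *
          (Complex.exp (L + φ * Complex.I) * Φ (L + φ * Complex.I)))) t := by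
    refine hasDerivAt_superposition (by fun_prop) ?_ (fun t ht => ?_) (fun t ht => ?_) ht
    · exact hsegc'.aestronglyMeasurable
    · exact ((hexpt t).mul hsegc').integrableOn_Icc.mono_set Ioc_subset_Icc_self
    · exact ((hexpt t).mul (hexpc.mul hsegc')).integrableOn_Icc.mono_set Ioc_subset_Icc_self
  have h := (((hray θ habs).sub (hray (-θ) habs')).add (hseg.const_mul Complex.I)).const_mul
    (2 * Real.pi * Complex.I)⁻¹
  have hle : -θ ≤ θ := by linarith
  simp only [← intervalIntegral.integral_of_le hle] at h
  exact h

theorem integrableOn_exp_mul_exp_exp {L c t : ℝ} (hc : c < 0) (ht : 0 < t) :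
    IntegrableOn (fun s => Real.exp s * Real.exp (t * (Real.exp s * c))) (Ioi L) ∧
    ∫ s in Ioi L, Real.exp s * Real.exp (t * (Real.exp s * c)) =
      -(Real.exp (t * (Real.exp L * c)) / (t * c)) := by
  have htc : t * c < 0 := mul_neg_of_pos_of_neg ht hc
  have hd : ∀ s : ℝ, HasDerivAt (fun s => Real.exp (t * (Real.exp s * c)) / (t * c))
      (Real.exp s * Real.exp (t * (Real.exp s * c))) s := by
    intro s
    have h1 := ((((Real.hasDerivAt_exp s).mul_const c).const_mul t).exp).div_const (t * c)
    have h2 : Real.exp s * Real.exp (t * (Real.exp s * c)) =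
        Real.exp (t * (Real.exp s * c)) * (t * (Real.exp s * c)) / (t * c) := by
      rw [eq_div_iff htc.ne]; ring
    rw [h2]
    exact h1
  have hlim : Tendsto (fun s => Real.exp (t * (Real.exp s * c)) / (t * c)) atTop (𝓝 0) := by
    have h1 : Tendsto (fun s => t * (Real.exp s * c)) atTop atBot :=
      (Real.tendsto_exp_atTop.atTop_mul_const_of_neg hc).const_mul_atBot ht
    simpa using (Real.tendsto_exp_atBot.comp h1).div_const (t * c)
  have hi := integrableOn_Ioi_deriv_of_nonneg (hd L).continuousAt.continuousWithinAt
    (fun s _ => hd s) (fun s _ => by positivity) hlim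
  refine ⟨hi, ?_⟩
  rw [integral_Ioi_of_hasDerivAt_of_tendsto (hd L).continuousAt.continuousWithinAt
    (fun s _ => hd s) hi hlim, zero_sub]

/-- The contribution of one ray of the contour. -/
theorem ray_integral_le {L θ β t : ℝ} (hθ : θ ∈ Ioo (Real.pi / 2) Real.pi) (hβ : β ≤ 1)
    (ht : Real.exp (-L) < t) :
    IntegrableOn (fun s => Real.exp (t * (Real.exp s * Real.cos θ)) * Real.exp (β * s)) (Ioi L) ∧
    ∫ s in Ioi L, Real.exp (t * (Real.exp s * Real.cos θ)) * Real.exp (β * s) ≤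
      (-1 / Real.cos θ) * t ^ (-β) * Real.exp (Real.cos θ) := by
  have hcos := cos_neg_of_mem hθ
  have ht0 := (Real.exp_pos _).trans ht
  obtain ⟨hi, hval⟩ := integrableOn_exp_mul_exp_exp (L := L) hcos ht0
  have hle : ∀ s ∈ Ioi L, Real.exp (t * (Real.exp s * Real.cos θ)) * Real.exp (β * s) ≤
      t ^ (1 - β) * (Real.exp s * Real.exp (t * (Real.exp s * Real.cos θ))) := by
    intro s hs
    have hs' : L < s := hs
    have h1 : Real.exp (-s) ≤ t := (Real.exp_le_exp.2 (by linarith)).trans ht.le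
    -- Replacing `exp (β s)` by a multiple of `exp s` makes the integrand an exact derivative. It
    -- uses `exp (-s) < exp (-L) < t` together with `β ≤ 1`.
    have h2 : Real.exp (β * s) ≤ t ^ (1 - β) * Real.exp s := by
      calc Real.exp (β * s) = Real.exp (-s) ^ (1 - β) * Real.exp s := by
            rw [← Real.exp_mul, ← Real.exp_add]; ring_nf
        _ ≤ _ := by
            gcongr
    calc _ ≤ Real.exp (t * (Real.exp s * Real.cos θ)) * (t ^ (1 - β) * Real.exp s) := by gcongr
      _ = _ := by ring
  have hint : IntegrableOn
      (fun s => Real.exp (t * (Real.exp s * Real.cos θ)) * Real.exp (β * s)) (Ioi L) := by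
    refine Integrable.mono' (hi.const_mul (t ^ (1 - β)))
      (Continuous.aestronglyMeasurable (by fun_prop)) ?_
    refine (ae_restrict_iff' measurableSet_Ioi).2 (Eventually.of_forall fun s hs => ?_)
    rw [Real.norm_of_nonneg (by positivity)]
    exact hle s hs
  refine ⟨hint, ?_⟩
  refine (setIntegral_mono_on hint (hi.const_mul _) measurableSet_Ioi hle).trans ?_
  rw [integral_const_mul, hval]
  have h3 : Real.exp (t * (Real.exp L * Real.cos θ)) ≤ Real.exp (Real.cos θ) := by
    apply Real.exp_le_exp.2
    have h4 : 1 ≤ t * Real.exp L := by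
      have := mul_le_mul_of_nonneg_right ht.le (Real.exp_pos L).le
      rwa [← Real.exp_add, neg_add_cancel, Real.exp_zero] at this
    nlinarith
  have h5 : t ^ (1 - β) * -(Real.exp (t * (Real.exp L * Real.cos θ)) / (t * Real.cos θ)) =
      (-1 / Real.cos θ) * t ^ (-β) * Real.exp (t * (Real.exp L * Real.cos θ)) := by
    rw [show 1 - β = -β + 1 by ring, Real.rpow_add_one ht0.ne']
    have := hcos.ne
    field_simp
  rw [h5]
  have h6 : 0 ≤ -1 / Real.cos θ := div_nonneg_of_nonpos (by norm_num) hcos.le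
  gcongr

/-- With the prefactor `1 / (2 π)`, the two equal ray bounds give `1 / π` and the arc, of angle `2
θ`, gives `θ / π`. Two exponents are carried because the two initial values enter with different
powers of `z`. -/
theorem norm_inverseLaplace_le {L θ T t A₁ A₂ β₁ β₂ : ℝ}
    (hθ : θ ∈ Ioo (Real.pi / 2) Real.pi) (ht : Real.exp (-L) < t) (htT : t ≤ T)
    (hβ₁ : β₁ ≤ 1) (hβ₂ : β₂ ≤ 1) (hA₁ : 0 ≤ A₁) (hA₂ : 0 ≤ A₂) {Φ : ℂ → ℂ}
    (hb : ∀ ζ : ℂ, L ≤ ζ.re →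
      ‖Complex.exp ζ * Φ ζ‖ ≤ A₁ * Real.exp (β₁ * ζ.re) + A₂ * Real.exp (β₂ * ζ.re)) :
    ‖inverseLaplace L θ Φ t‖ ≤
      A₁ / Real.pi * ((-1 / Real.cos θ) * t ^ (-β₁) * Real.exp (Real.cos θ)
          + θ * Real.exp (β₁ * L) * Real.exp (Real.exp L * T)) +
      A₂ / Real.pi * ((-1 / Real.cos θ) * t ^ (-β₂) * Real.exp (Real.cos θ)
          + θ * Real.exp (β₂ * L) * Real.exp (Real.exp L * T)) := by
  have hθ0 : 0 < θ := by linarith [hθ.1, Real.pi_pos]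
  have ht0 := (Real.exp_pos _).trans ht
  obtain ⟨hi₁, hv₁⟩ := ray_integral_le hθ hβ₁ ht
  obtain ⟨hi₂, hv₂⟩ := ray_integral_le hθ hβ₂ ht
  set R₁ := (-1 / Real.cos θ) * t ^ (-β₁) * Real.exp (Real.cos θ)
  set R₂ := (-1 / Real.cos θ) * t ^ (-β₂) * Real.exp (Real.cos θ)
  have hray : ∀ η : ℝ, |η| = θ → ‖∫ s in Ioi L,
      Complex.exp (t * Complex.exp (s + η * Complex.I)) *
        (Complex.exp (s + η * Complex.I) * Φ (s + η * Complex.I))‖ ≤ A₁ * R₁ + A₂ * R₂ := by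
    intro η hη
    refine (norm_integral_le_of_norm_le ((hi₁.const_mul A₁).add (hi₂.const_mul A₂)) ?_).trans ?_
    · refine (ae_restrict_iff' measurableSet_Ioi).2 (Eventually.of_forall fun s hs => ?_)
      have h1 := hb (s + η * Complex.I) (by simpa using le_of_lt hs)
      have hre : ((s : ℂ) + η * Complex.I).re = s := by simp
      rw [hre] at h1
      rw [norm_mul, Complex.norm_exp, Complex.re_ofReal_mul, re_exp_ray hη]
      refine (mul_le_mul_of_nonneg_left h1 (Real.exp_pos _).le).trans (le_of_eq ?_)
      simp only [Pi.add_apply]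
      ring
    · simp only [Pi.add_apply]
      rw [integral_add (hi₁.const_mul A₁) (hi₂.const_mul A₂), integral_const_mul,
        integral_const_mul]
      gcongr
  have hseg : ‖∫ φ in (-θ)..θ, Complex.exp (t * Complex.exp (L + φ * Complex.I)) *
        (Complex.exp (L + φ * Complex.I) * Φ (L + φ * Complex.I))‖ ≤
      Real.exp (Real.exp L * T) * (A₁ * Real.exp (β₁ * L) + A₂ * Real.exp (β₂ * L)) *
        |θ - -θ| := by
    refine intervalIntegral.norm_integral_le_of_norm_le_const fun φ _ => ?_
    have h1 := hb (L + φ * Complex.I) (by simp)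
    have hre : ((L : ℂ) + φ * Complex.I).re = L := by simp
    rw [hre] at h1
    rw [norm_mul]
    refine mul_le_mul ?_ h1 (norm_nonneg _) (Real.exp_pos _).le
    rw [Complex.norm_exp, Complex.re_ofReal_mul]
    apply Real.exp_le_exp.2
    have h2 : (Complex.exp (L + φ * Complex.I)).re ≤ Real.exp L := by
      refine (Complex.re_le_norm _).trans (le_of_eq ?_)
      rw [Complex.norm_exp, hre]
    nlinarith [Real.exp_pos L]
  rw [inverseLaplace, contour, norm_mul, norm_inv, norm_mul, norm_mul, Complex.norm_I, mul_one,
    Complex.norm_real, Real.norm_of_nonneg Real.pi_pos.le, RCLike.norm_ofNat]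
  have h1 := hray θ (abs_of_pos hθ0)
  have h2 := hray (-θ) (by rw [abs_neg, abs_of_pos hθ0])
  rw [abs_of_pos (by linarith : 0 < θ - -θ)] at hseg
  have hpi := Real.pi_pos
  set J := ∫ φ in (-θ)..θ, Complex.exp (t * Complex.exp (L + φ * Complex.I)) *
        (Complex.exp (L + φ * Complex.I) * Φ (L + φ * Complex.I))
  have hIJ : ‖Complex.I * J‖ = ‖J‖ := by rw [norm_mul, Complex.norm_I, one_mul]
  have htot := (norm_add_le _ _).trans (add_le_add ((norm_sub_le _ _).trans (add_le_add h1 h2))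
    (hIJ.trans_le hseg))
  refine (mul_le_mul_of_nonneg_left htot (inv_nonneg.2 (by positivity : 0 ≤ 2 * Real.pi))).trans (le_of_eq ?_)
  field_simp
  ring

/-! ### Bounds for the symbols -/

/-- The symbol `(z + c) ^ (-α)` of the weighted fractional integral, in the variable `z = exp ζ`,
with the branch that is holomorphic for `‖c‖ < ‖z‖`. -/
def kernelSymbol (α : ℝ) (c ζ : ℂ) : ℂ :=
  Complex.exp (-(α * ζ)) * (1 + c * Complex.exp (-ζ)) ^ (-α : ℂ)

theorem norm_mul_exp_neg_le {L : ℝ} {c ζ : ℂ} (hc : 2 * ‖c‖ ≤ Real.exp L) (hζ : L ≤ ζ.re) :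
    ‖c * Complex.exp (-ζ)‖ ≤ 1 / 2 := by
  rw [norm_mul, Complex.norm_exp, Complex.neg_re]
  calc ‖c‖ * Real.exp (-ζ.re) ≤ (Real.exp L / 2) * Real.exp (-L) := by gcongr; linarith
    _ = 1 / 2 := by rw [Real.exp_neg]; field_simp

theorem half_le_norm_one_add {w : ℂ} (hw : ‖w‖ ≤ 1 / 2) : 1 / 2 ≤ ‖1 + w‖ := by
  have h := norm_sub_le (1 + w) w
  rw [add_sub_cancel_right, norm_one] at h
  linarith

theorem one_add_mem_slitPlane {w : ℂ} (hw : ‖w‖ ≤ 1 / 2) : 1 + w ∈ Complex.slitPlane := by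
  left
  have := (abs_le.1 (Complex.abs_re_le_norm w)).1
  simp
  linarith

theorem differentiableAt_kernelSymbol {L α : ℝ} {c ζ : ℂ} (hc : 2 * ‖c‖ ≤ Real.exp L)
    (hζ : L ≤ ζ.re) : DifferentiableAt ℂ (kernelSymbol α c) ζ := by
  have h := one_add_mem_slitPlane (norm_mul_exp_neg_le hc hζ)
  refine DifferentiableAt.mul (by fun_prop) (DifferentiableAt.cpow_const (by fun_prop) h)

theorem norm_kernelSymbol_le {L α : ℝ} (hα : 0 < α) {c ζ : ℂ} (hc : 2 * ‖c‖ ≤ Real.exp L)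
    (hζ : L ≤ ζ.re) : ‖kernelSymbol α c ζ‖ ≤ 2 ^ α * Real.exp (-α * ζ.re) := by
  have h := half_le_norm_one_add (norm_mul_exp_neg_le hc hζ)
  rw [kernelSymbol, norm_mul, Complex.norm_exp, mul_comm, ← Complex.ofReal_neg,
    Complex.norm_cpow_real]
  have h1 : ‖1 + c * Complex.exp (-ζ)‖ ^ (-α) ≤ 2 ^ α := by
    calc ‖1 + c * Complex.exp (-ζ)‖ ^ (-α) ≤ (1 / 2 : ℝ) ^ (-α) :=
          Real.rpow_le_rpow_of_nonpos (by norm_num) h (by linarith)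
      _ = 2 ^ α := by rw [one_div, Real.inv_rpow (by norm_num), Real.rpow_neg (by norm_num), inv_inv]
  have h2 : (-(α * ζ)).re = -α * ζ.re := by simp
  rw [h2]
  gcongr

theorem kernelSymbol_log {α x : ℝ} {c : ℂ} (hx : 0 < x) (hc : 2 * ‖c‖ ≤ x) :
    kernelSymbol α c (Real.log x) = (x + c) ^ (-α : ℂ) := by
  have h1 : Complex.exp (-(Real.log x : ℂ)) = (x : ℂ)⁻¹ := by
    rw [Complex.exp_neg, ← Complex.ofReal_exp, Real.exp_log hx]
  have hw : ‖c * (x : ℂ)⁻¹‖ ≤ 1 / 2 := by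
    rw [← h1]
    exact norm_mul_exp_neg_le (L := Real.log x) (by rwa [Real.exp_log hx]) (by simp)
  have hne := Complex.slitPlane_ne_zero (one_add_mem_slitPlane hw)
  have hx' : (x : ℂ) ≠ 0 := Complex.ofReal_ne_zero.2 hx.ne'
  have h2 : (x : ℂ) + c = x * (1 + c * (x : ℂ)⁻¹) := by field_simp
  rw [kernelSymbol, h1, h2, Complex.cpow_def_of_ne_zero hne,
    Complex.cpow_def_of_ne_zero (mul_ne_zero hx' hne), Complex.log_ofReal_mul hx hne,
    ← Complex.exp_add]
  ring_nf

/-- From `1 - u - v = (1 - u)(1 - v) - u v`, the modulus is at least `1/4 - 1/8`. Moreover it is at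
least `‖1 - v‖ / 2 - 1/8`, and `1/8 ≤ ‖1 - v‖ / 4`. -/
theorem determinant_bounds {u v : ℂ} (hu : ‖u‖ ≤ 1 / 2) (hv : ‖v‖ ≤ 1 / 2)
    (huv : ‖u‖ * ‖v‖ ≤ 1 / 8) :
    1 / 8 ≤ ‖1 - u - v‖ ∧ ‖1 - v‖ ≤ 4 * ‖1 - u - v‖ := by
  have h1 : 1 / 2 ≤ ‖1 - u‖ := by
    simpa [sub_eq_add_neg] using half_le_norm_one_add (w := -u) (by simpa using hu)
  have h2 : 1 / 2 ≤ ‖1 - v‖ := by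
    simpa [sub_eq_add_neg] using half_le_norm_one_add (w := -v) (by simpa using hv)
  have h3 := norm_sub_norm_le ((1 - u) * (1 - v)) (u * v)
  rw [show (1 - u) * (1 - v) - u * v = 1 - u - v by ring, norm_mul, norm_mul] at h3
  constructor <;> nlinarith

/-- The Laplace transform of the `j`-th component of the solution, in the variable `z = exp ζ`. -/
def solutionSymbol (α a : Fin 2 → ℝ) (c G₀ : Fin 2 → ℂ) (j k : Fin 2) (ζ : ℂ) : ℂ :=
  ((1 - a k * kernelSymbol (α k) (c k) ζ) * G₀ j - a k * kernelSymbol (α k) (c k) ζ * G₀ k) /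
    ((Complex.exp ζ + c j) *
      (1 - a j * kernelSymbol (α j) (c j) ζ - a k * kernelSymbol (α k) (c k) ζ))

theorem half_exp_le_norm {L : ℝ} {c ζ : ℂ} (hc : 2 * ‖c‖ ≤ Real.exp L) (hζ : L ≤ ζ.re) :
    Real.exp ζ.re / 2 ≤ ‖Complex.exp ζ + c‖ := by
  have h := norm_sub_le (Complex.exp ζ + c) c
  rw [add_sub_cancel_right, Complex.norm_exp] at h
  have := Real.exp_le_exp.2 hζ
  linarith

section symbol

variable {α a : Fin 2 → ℝ} {c G₀ : Fin 2 → ℂ} {L : ℝ} {j k : Fin 2} {ζ : ℂ}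

theorem norm_mul_kernelSymbol_le (hα : ∀ j, 0 < α j ∧ α j < 1)
    (hc : ∀ j, 2 * ‖c j‖ ≤ Real.exp L) (hζ : L ≤ ζ.re) (j : Fin 2) :
    ‖a j * kernelSymbol (α j) (c j) ζ‖ ≤ 2 * |a j| * Real.exp (-α j * ζ.re) := by
  rw [norm_mul, Complex.norm_real, Real.norm_eq_abs]
  have h1 := norm_kernelSymbol_le (hα j).1 (hc j) hζ
  have h2 : (2 : ℝ) ^ (α j) ≤ 2 := by
    calc (2 : ℝ) ^ (α j) ≤ 2 ^ (1 : ℝ) :=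
          Real.rpow_le_rpow_of_exponent_le (by norm_num) (hα j).2.le
      _ = 2 := Real.rpow_one 2
  calc _ ≤ |a j| * (2 * Real.exp (-α j * ζ.re)) := by
        refine mul_le_mul_of_nonneg_left (h1.trans ?_) (abs_nonneg _)
        gcongr
    _ = _ := by ring

/-- Each `a_i y_i` is at most `2 |a_i| exp (-α_i L)`. The constant `4` in the hypotheses turns this
into `1/2`, and `32` turns the product of the two into `4/32 = 1/8`, the inputs of
`determinant_bounds`. -/
theorem symbol_bounds (hα : ∀ j, 0 < α j ∧ α j < 1)
    (hc : ∀ j, 2 * ‖c j‖ ≤ Real.exp L) (ha : ∀ j, 4 * |a j| ≤ Real.exp (α j * L))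
    (haa : 32 * |a 0 * a 1| ≤ Real.exp ((α 0 + α 1) * L)) (hζ : L ≤ ζ.re) (hjk : k ≠ j) :
    ‖a k * kernelSymbol (α k) (c k) ζ‖ ≤ 1 / 2 ∧
    1 / 8 ≤ ‖1 - a j * kernelSymbol (α j) (c j) ζ - a k * kernelSymbol (α k) (c k) ζ‖ ∧
    ‖1 - a k * kernelSymbol (α k) (c k) ζ‖ ≤
      4 * ‖1 - a j * kernelSymbol (α j) (c j) ζ - a k * kernelSymbol (α k) (c k) ζ‖ := by
  have hx : ∀ i, ‖a i * kernelSymbol (α i) (c i) ζ‖ ≤ 2 * |a i| * Real.exp (-α i * L) := by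
    intro i
    refine (norm_mul_kernelSymbol_le hα hc hζ i).trans ?_
    gcongr ?_ * Real.exp ?_
    nlinarith [(hα i).1]
  have hhalf : ∀ i, 2 * |a i| * Real.exp (-α i * L) ≤ 1 / 2 := by
    intro i
    have := mul_le_mul_of_nonneg_right (ha i) (Real.exp_pos (-α i * L)).le
    rw [← Real.exp_add, show α i * L + -α i * L = 0 by ring, Real.exp_zero] at this
    linarith
  have hprod : (2 * |a 0| * Real.exp (-α 0 * L)) * (2 * |a 1| * Real.exp (-α 1 * L)) ≤ 1 / 8 := by
    have := mul_le_mul_of_nonneg_right haa (Real.exp_pos (-(α 0 + α 1) * L)).le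
    rw [← Real.exp_add, show (α 0 + α 1) * L + -(α 0 + α 1) * L = 0 by ring, Real.exp_zero,
      show -(α 0 + α 1) * L = -α 0 * L + -α 1 * L by ring, Real.exp_add, abs_mul] at this
    linarith
  have hprod' : ‖a j * kernelSymbol (α j) (c j) ζ‖ * ‖a k * kernelSymbol (α k) (c k) ζ‖ ≤ 1 / 8 := by
    have h0 : ‖a 0 * kernelSymbol (α 0) (c 0) ζ‖ * ‖a 1 * kernelSymbol (α 1) (c 1) ζ‖ ≤ 1 / 8 :=
      (mul_le_mul (hx 0) (hx 1) (norm_nonneg _) (by positivity)).trans hprod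
    fin_cases j <;> fin_cases k
    · exact absurd rfl hjk
    · exact h0
    · rw [mul_comm]; exact h0
    · exact absurd rfl hjk
  exact ⟨(hx k).trans (hhalf k), determinant_bounds ((hx j).trans (hhalf j))
    ((hx k).trans (hhalf k)) hprod'⟩

theorem differentiableAt_solutionSymbol (hα : ∀ j, 0 < α j ∧ α j < 1)
    (hc : ∀ j, 2 * ‖c j‖ ≤ Real.exp L) (ha : ∀ j, 4 * |a j| ≤ Real.exp (α j * L))
    (haa : 32 * |a 0 * a 1| ≤ Real.exp ((α 0 + α 1) * L)) (hζ : L ≤ ζ.re) (hjk : k ≠ j) :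
    DifferentiableAt ℂ (solutionSymbol α a c G₀ j k) ζ := by
  obtain ⟨-, h1, -⟩ := symbol_bounds hα hc ha haa hζ hjk
  have hj := differentiableAt_kernelSymbol (α := α j) (hc j) hζ
  have hk := differentiableAt_kernelSymbol (α := α k) (hc k) hζ
  have hw := half_exp_le_norm (hc j) hζ
  refine DifferentiableAt.div (by fun_prop) (by fun_prop) (mul_ne_zero ?_ ?_)
  · rw [← norm_pos_iff]; linarith [Real.exp_pos ζ.re]
  · rw [← norm_pos_iff]; linarith

/-- The factor `exp ζ / (exp ζ + c j)` costs `2`. The coefficient of `G₀ j` costs `4` more, giving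
`8`; that of `G₀ k` costs `2 |a k|` from the kernel and `8` from the determinant, giving `32`. -/
theorem norm_exp_mul_solutionSymbol_le (hα : ∀ j, 0 < α j ∧ α j < 1)
    (hc : ∀ j, 2 * ‖c j‖ ≤ Real.exp L) (ha : ∀ j, 4 * |a j| ≤ Real.exp (α j * L))
    (haa : 32 * |a 0 * a 1| ≤ Real.exp ((α 0 + α 1) * L)) (hζ : L ≤ ζ.re) (hjk : k ≠ j) :
    ‖Complex.exp ζ * solutionSymbol α a c G₀ j k ζ‖ ≤
      32 * |a k| * ‖G₀ k‖ * Real.exp (-α k * ζ.re) + 8 * ‖G₀ j‖ := by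
  obtain ⟨-, h1, h2⟩ := symbol_bounds hα hc ha haa hζ hjk
  have h3 := norm_mul_kernelSymbol_le (a := a) hα hc hζ k
  have hw := half_exp_le_norm (hc j) hζ
  have he := Real.exp_pos ζ.re
  set u := (a j : ℂ) * kernelSymbol (α j) (c j) ζ
  set v := (a k : ℂ) * kernelSymbol (α k) (c k) ζ
  set D := ‖1 - u - v‖ with hD
  have hnum : ‖(1 - v) * G₀ j - v * G₀ k‖ ≤
      4 * D * ‖G₀ j‖ + 2 * |a k| * Real.exp (-α k * ζ.re) * ‖G₀ k‖ := by
    refine (norm_sub_le _ _).trans ?_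
    rw [norm_mul, norm_mul]
    gcongr
  have hpos : 0 < ‖Complex.exp ζ + c j‖ * D := mul_pos (by linarith) (by linarith)
  rw [solutionSymbol, norm_mul, norm_div, norm_mul, Complex.norm_exp, ← mul_div_assoc,
    div_le_iff₀ hpos]
  set E := Real.exp ζ.re
  set S := |a k| * Real.exp (-α k * ζ.re) * ‖G₀ k‖ with hS
  have hS0 : 0 ≤ S := by positivity
  have hg0 := norm_nonneg (G₀ j)
  calc E * ‖(1 - v) * G₀ j - v * G₀ k‖ ≤ E * (4 * D * ‖G₀ j‖ + 2 * S) := by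
        gcongr; exact hnum.trans (le_of_eq (by rw [hS]; ring))
    _ ≤ E * (4 * D * ‖G₀ j‖ + 16 * S * D) := by
        have h4 : 2 * S ≤ 16 * S * D := by nlinarith
        gcongr
    _ = (32 * S + 8 * ‖G₀ j‖) * (E / 2 * D) := by ring
    _ ≤ (32 * S + 8 * ‖G₀ j‖) * (‖Complex.exp ζ + c j‖ * D) := by gcongr
    _ = _ := by rw [hS]; ring

end symbol

/-! ### The system under the truncated Laplace transform -/

/-- A function continuous on `(0, T]` with a limit at `0` is bounded. -/
theorem exists_bound_of_tendsto {T : ℝ} {f : ℝ → ℂ} {l : ℂ} (hf : ContinuousOn f (Ioc 0 T))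
    (hl : Tendsto f (𝓝[>] 0) (𝓝 l)) : ∃ M, 0 ≤ M ∧ ∀ t ∈ Ioc 0 T, ‖f t‖ ≤ M := by
  have h1 : ∀ᶠ t in 𝓝[>] 0, ‖f t‖ < ‖l‖ + 1 := hl.norm.eventually (gt_mem_nhds (by linarith))
  obtain ⟨ε, hε, hsub⟩ := mem_nhdsGT_iff_exists_Ioo_subset.1 h1
  have hε' : 0 < ε := hε
  have hc : ContinuousOn f (Icc (ε / 2) T) :=
    hf.mono fun t ht => ⟨by linarith [ht.1], ht.2⟩
  obtain ⟨M, hM⟩ := isCompact_Icc.exists_bound_of_continuousOn hc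
  refine ⟨max M (‖l‖ + 1), le_max_of_le_right (by positivity), fun t ht => ?_⟩
  rcases lt_or_ge t ε with h | h
  · exact (hsub ⟨ht.1, h⟩ : ‖f t‖ < ‖l‖ + 1).le.trans (le_max_right _ _)
  · exact (hM t ⟨by linarith, ht.2⟩).trans (le_max_left _ _)

theorem integrableOn_of_bound {T M : ℝ} {f : ℝ → ℂ} (hf : ContinuousOn f (Ioc 0 T))
    (hM : ∀ t ∈ Ioc 0 T, ‖f t‖ ≤ M) : IntegrableOn f (Ioc 0 T) :=
  IntegrableOn.of_bound (by simp) (hf.aestronglyMeasurable measurableSet_Ioc) M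
    ((ae_restrict_iff' measurableSet_Ioc).2 (Eventually.of_forall hM))

/-- The convolution kernel of the weighted fractional integral. -/
def kernel (α : ℝ) (c : ℂ) (s : ℝ) : ℂ :=
  ((1 / Real.Gamma α : ℝ) : ℂ) * (Complex.exp (-(s : ℂ) * c) / ((s ^ (1 - α) : ℝ) : ℂ))

theorem substantialIntegral_eq (α : ℝ) (c : ℂ) (g : ℝ → ℂ) (t : ℝ) :
    substantialIntegral α c g t = ∫ τ in (0 : ℝ)..t, kernel α c (t - τ) * g τ := by
  rw [substantialIntegral, ← intervalIntegral.integral_const_mul]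
  simp only [kernel, mul_assoc]

theorem exp_mul_kernel {α x s : ℝ} {c : ℂ} (hs : 0 < s) :
    ((Real.exp (-(x * s)) : ℝ) : ℂ) * kernel α c s = ((1 / Real.Gamma α : ℝ) : ℂ) *
      (((s ^ (α - 1) : ℝ) : ℂ) * Complex.exp (-((x + c) * s))) := by
  rw [kernel, show α - 1 = -(1 - α) by ring, Real.rpow_neg hs.le, Complex.ofReal_inv,
    show -((x + c) * s) = ((-(x * s) : ℝ) : ℂ) + -(s : ℂ) * c by push_cast; ring,
    Complex.exp_add, Complex.ofReal_exp, div_eq_mul_inv]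
  ring

theorem integrableOn_exp_mul_kernel {α x : ℝ} {c : ℂ} (hα : 0 < α) (hx : ‖c‖ < x) :
    IntegrableOn (fun s => ((Real.exp (-(x * s)) : ℝ) : ℂ) * kernel α c s) (Ioi 0) := by
  have hre : 0 < ((x : ℂ) + c).re := by
    have := (abs_le.1 (Complex.abs_re_le_norm c)).1
    simp; linarith
  exact IntegrableOn.congr_fun
    ((integrableOn_rpow_mul_cexp hα hre).const_mul ((1 / Real.Gamma α : ℝ) : ℂ))
    (fun s hs => (exp_mul_kernel hs).symm) measurableSet_Ioi

theorem laplace_kernel {α x : ℝ} {c : ℂ} (hα : 0 < α) (hx : ‖c‖ < x) :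
    ∫ s in Ioi 0, ((Real.exp (-(x * s)) : ℝ) : ℂ) * kernel α c s = (x + c) ^ (-α : ℂ) := by
  have hre : 0 < ((x : ℂ) + c).re := by
    have := (abs_le.1 (Complex.abs_re_le_norm c)).1
    simp; linarith
  rw [setIntegral_congr_fun measurableSet_Ioi (fun s hs => exp_mul_kernel hs),
    integral_const_mul, integral_rpow_mul_cexp hα hre, mul_left_comm, ← Complex.ofReal_mul,
    one_div, inv_mul_cancel₀ (Real.Gamma_pos_of_pos hα).ne', Complex.ofReal_one, mul_one]

theorem norm_substantialIntegral_le {α T M t : ℝ} {c : ℂ} {g : ℝ → ℂ} (hα : 0 < α)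
    (hM : ∀ t ∈ Ioc 0 T, ‖g t‖ ≤ M) (ht : t ∈ Ioc 0 T) :
    ‖substantialIntegral α c g t‖ ≤
      1 / Real.Gamma α * Real.exp (‖c‖ * T) * M * (t ^ α / α) := by
  have hΓ := Real.Gamma_pos_of_pos hα
  have hint : ∫ τ in (0 : ℝ)..t, (t - τ) ^ (α - 1) = t ^ α / α := by
    rw [intervalIntegral.integral_comp_sub_left (fun s => s ^ (α - 1)), sub_self, sub_zero,
      integral_rpow (Or.inl (by linarith)), sub_add_cancel, Real.zero_rpow hα.ne', sub_zero]
  have hii : IntervalIntegrable (fun τ => (t - τ) ^ (α - 1)) volume 0 t := by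
    have h := (intervalIntegral.intervalIntegrable_rpow' (a := 0) (b := t) (r := α - 1)
      (by linarith)).comp_sub_left t
    simpa using h.symm
  rw [substantialIntegral_eq, ← hint, ← intervalIntegral.integral_const_mul]
  refine intervalIntegral.norm_integral_le_of_norm_le ht.1.le ?_ (hii.const_mul _)
  have hne : ∀ᵐ τ : ℝ, τ ≠ t := by simp [ae_iff]
  filter_upwards [hne] with τ hτt hτ
  have hs : 0 < t - τ := sub_pos.2 (lt_of_le_of_ne hτ.2 hτt)
  have hg := hM τ ⟨hτ.1, hτ.2.trans ht.2⟩
  rw [norm_mul, kernel, norm_mul, norm_div, Complex.norm_real, Complex.norm_real,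
    Real.norm_of_nonneg (by positivity), Real.norm_of_nonneg (by positivity), Complex.norm_exp,
    show α - 1 = -(1 - α) by ring, Real.rpow_neg hs.le]
  have he : (-((t - τ : ℝ) : ℂ) * c).re ≤ ‖c‖ * T := by
    calc (-((t - τ : ℝ) : ℂ) * c).re ≤ ‖-((t - τ : ℝ) : ℂ) * c‖ := Complex.re_le_norm _
      _ = ‖c‖ * (t - τ) := by
        rw [norm_mul, norm_neg, Complex.norm_real, Real.norm_of_nonneg hs.le, mul_comm]
      _ ≤ ‖c‖ * T := by gcongr; linarith [hτ.1, ht.2]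
  calc _ ≤ 1 / Real.Gamma α * (Real.exp (‖c‖ * T) / (t - τ) ^ (1 - α)) * M := by gcongr
    _ = _ := by rw [div_eq_mul_inv (Real.exp _)]; ring

/-- For bounded `g` the fractional integral is `O(t ^ α)`. Thus the fractional terms contribute
nothing to the initial value of `flux`. -/
theorem tendsto_substantialIntegral {α T M : ℝ} {c : ℂ} {g : ℝ → ℂ} (hα : 0 < α) (hT : 0 < T)
    (hM : ∀ t ∈ Ioc 0 T, ‖g t‖ ≤ M) :
    Tendsto (substantialIntegral α c g) (𝓝[>] 0) (𝓝 0) := by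
  have h1 : Tendsto (fun t : ℝ => 1 / Real.Gamma α * Real.exp (‖c‖ * T) * M * (t ^ α / α)) (𝓝[>] 0)
      (𝓝 (1 / Real.Gamma α * Real.exp (‖c‖ * T) * M * (0 ^ α / α))) :=
    ((((Real.continuous_rpow_const hα.le).tendsto 0).mono_left nhdsWithin_le_nhds).div_const
      α).const_mul _
  rw [Real.zero_rpow hα.ne', zero_div, mul_zero] at h1
  refine squeeze_zero_norm' ?_ h1
  filter_upwards [Ioc_mem_nhdsGT hT] with t ht
  exact norm_substantialIntegral_le hα hM ht

/-- The coefficients `m_j / B_j`. -/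
def coef (p b : ℝ) (B : Fin 2 → ℝ) (j : Fin 2) : ℝ := m p b j * (B j)⁻¹

section solution

variable {T p b : ℝ} {α B U : Fin 2 → ℝ} {ρ : ℂ} {G₀ : Fin 2 → ℂ} {G : Fin 2 → ℝ → ℂ}

/-- The system solved for the derivative of one component. -/
theorem IsSolution.equation (hG : IsSolution T p b α B U ρ G₀ G) (hpb : p + b ≠ 1) {j k : Fin 2}
    (hjk : k ≠ j) {t : ℝ} (ht : t ∈ Ioc 0 T) :
    timeDeriv T (G j) t + ρ * U j * G j t =
      coef p b B j * substantialDeriv T (α j) (ρ * U j) (G j) t -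
        coef p b B k * substantialDeriv T (α k) (ρ * U k) (G k) t := by
  have h1 := hG.equation_one t ht
  have h2 := hG.equation_two t ht
  have hne : (1 - p - b : ℂ) ≠ 0 := by
    have : 1 - p - b ≠ 0 := fun h => hpb (by linarith)
    exact_mod_cast this
  fin_cases j <;> fin_cases k
  · exact absurd rfl hjk
  · simp only [coef, m, Fin.zero_eta, Fin.mk_one, Matrix.cons_val_zero, Matrix.cons_val_one]
    push_cast
    apply mul_left_cancel₀ hne
    field_simp
    linear_combination (1 - b : ℂ) * h2 - (b : ℂ) * h1
  · simp only [coef, m, Fin.zero_eta, Fin.mk_one, Matrix.cons_val_zero, Matrix.cons_val_one]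
    push_cast
    apply mul_left_cancel₀ hne
    field_simp
    linear_combination (1 - p : ℂ) * h1 - (p : ℂ) * h2
  · exact absurd rfl hjk

/-- The combination of a component and the fractional integrals whose derivative is continuous. -/
def flux (p b : ℝ) (α B U : Fin 2 → ℝ) (ρ : ℂ) (G : Fin 2 → ℝ → ℂ) (j k : Fin 2) (t : ℝ) : ℂ :=
  G j t - coef p b B j * substantialIntegral (α j) (ρ * U j) (G j) t +
    coef p b B k * substantialIntegral (α k) (ρ * U k) (G k) t

theorem hasDerivAt_timeDeriv {g : ℝ → ℂ} (hg : DifferentiableOn ℝ g (Ioc 0 T)) {t : ℝ}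
    (ht : t ∈ Ioo 0 T) : HasDerivAt g (timeDeriv T g t) t :=
  (hg t (Ioo_subset_Ioc_self ht)).hasDerivWithinAt.hasDerivAt (Ioc_mem_nhds ht.1 ht.2)

/-- The derivatives of the component and of the fractional integrals are not known to be integrable
near `0`. In this combination the system cancels them, leaving only undifferentiated, bounded terms.
-/
theorem IsSolution.hasDerivAt_flux (hG : IsSolution T p b α B U ρ G₀ G) (hpb : p + b ≠ 1)
    {j k : Fin 2} (hjk : k ≠ j) {t : ℝ} (ht : t ∈ Ioo 0 T) :
    HasDerivAt (flux p b α B U ρ G j k)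
      (-(ρ * U j * (G j t - coef p b B j * substantialIntegral (α j) (ρ * U j) (G j) t) +
        ρ * U k * (coef p b B k * substantialIntegral (α k) (ρ * U k) (G k) t))) t := by
  have h := hG.equation hpb hjk (Ioo_subset_Ioc_self ht)
  rw [substantialDeriv, substantialDeriv] at h
  have h1 := ((hasDerivAt_timeDeriv (hG.differentiable j) ht).sub
    ((hasDerivAt_timeDeriv (hG.differentiable_integral j) ht).const_mul
      (coef p b B j : ℂ))).add
    ((hasDerivAt_timeDeriv (hG.differentiable_integral k) ht).const_mul (coef p b B k : ℂ))
  have h2 : -(ρ * U j * (G j t - coef p b B j * substantialIntegral (α j) (ρ * U j) (G j) t) +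
        ρ * U k * (coef p b B k * substantialIntegral (α k) (ρ * U k) (G k) t)) =
      timeDeriv T (G j) t -
        coef p b B j * timeDeriv T (substantialIntegral (α j) (ρ * U j) (G j)) t +
        coef p b B k * timeDeriv T (substantialIntegral (α k) (ρ * U k) (G k)) t := by
    linear_combination -h
  rw [h2]
  exact h1

theorem IsSolution.bounds (hG : IsSolution T p b α B U ρ G₀ G) (j : Fin 2) :
    ∃ M, 0 ≤ M ∧ ∀ t ∈ Ioc 0 T, ‖G j t‖ ≤ M :=
  exists_bound_of_tendsto (hG.differentiable j).continuousOn (hG.initial j)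

theorem IsSolution.tendsto_integral (hG : IsSolution T p b α B U ρ G₀ G)
    (hα : ∀ j, 0 < α j ∧ α j < 1) (hT : 0 < T) (j : Fin 2) :
    Tendsto (substantialIntegral (α j) (ρ * U j) (G j)) (𝓝[>] 0) (𝓝 0) :=
  let ⟨_, _, hM⟩ := hG.bounds j
  tendsto_substantialIntegral (hα j).1 hT hM

theorem IsSolution.integrableOn (hG : IsSolution T p b α B U ρ G₀ G) (j : Fin 2) :
    IntegrableOn (G j) (Ioc 0 T) :=
  let ⟨_, _, hM⟩ := hG.bounds j
  integrableOn_of_bound (hG.differentiable j).continuousOn hM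

theorem IsSolution.integrableOn_integral (hG : IsSolution T p b α B U ρ G₀ G)
    (hα : ∀ j, 0 < α j ∧ α j < 1) (hT : 0 < T) (j : Fin 2) :
    IntegrableOn (substantialIntegral (α j) (ρ * U j) (G j)) (Ioc 0 T) :=
  let ⟨_, _, hM⟩ := exists_bound_of_tendsto (hG.differentiable_integral j).continuousOn
    (hG.tendsto_integral hα hT j)
  integrableOn_of_bound (hG.differentiable_integral j).continuousOn hM

/-- The system after a Laplace transform truncated at time `T`. -/
theorem IsSolution.laplace_equation (hG : IsSolution T p b α B U ρ G₀ G) (hpb : p + b ≠ 1)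
    (hα : ∀ j, 0 < α j ∧ α j < 1) (hT : 0 < T) {j k : Fin 2} (hjk : k ≠ j) (x : ℝ) :
    (x + ρ * U j) * ((∫ t in Ioc 0 T, ((Real.exp (-(x * t)) : ℝ) : ℂ) * G j t) -
        coef p b B j * ∫ t in Ioc 0 T, ((Real.exp (-(x * t)) : ℝ) : ℂ) *
          substantialIntegral (α j) (ρ * U j) (G j) t) +
      (x + ρ * U k) * (coef p b B k * ∫ t in Ioc 0 T, ((Real.exp (-(x * t)) : ℝ) : ℂ) *
          substantialIntegral (α k) (ρ * U k) (G k) t) =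
      G₀ j - ((Real.exp (-(x * T)) : ℝ) : ℂ) * flux p b α B U ρ G j k T := by
  set e : ℝ → ℂ := fun t => ((Real.exp (-(x * t)) : ℝ) : ℂ) with he
  set I : Fin 2 → ℝ → ℂ := fun j => substantialIntegral (α j) (ρ * U j) (G j) with hI
  set S := flux p b α B U ρ G j k with hS
  have hed : ∀ t, HasDerivAt e (-(x * e t)) t := by
    intro t
    have h1 : HasDerivAt (fun t : ℝ => Real.exp (-(x * t))) (Real.exp (-(x * t)) * -(x * 1)) t :=
      (((hasDerivAt_id t).const_mul x).neg).exp
    have h2 := h1.ofReal_comp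
    have h3 : -(x * e t) = ((Real.exp (-(x * t)) * -(x * 1) : ℝ) : ℂ) := by
      simp only [he]; push_cast; ring
    rw [h3]
    exact h2
  have hec : Continuous e := continuous_iff_continuousAt.2 fun t => (hed t).continuousAt
  set F : ℝ → ℂ := fun t => (x + ρ * U j) * (e t * G j t - coef p b B j * (e t * I j t)) +
    (x + ρ * U k) * (coef p b B k * (e t * I k t)) with hF
  have hd : ∀ t ∈ Ioo 0 T, HasDerivAt (fun t => e t * S t) (-F t) t := by
    intro t ht
    have h1 := (hed t).mul (hG.hasDerivAt_flux hpb hjk ht)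
    have h2 : -F t = -(x * e t) * S t + e t * -(ρ * U j * (G j t - coef p b B j * I j t) +
        ρ * U k * (coef p b B k * I k t)) := by
      simp only [hF, hS, flux, hI]
      ring
    rw [h2]
    exact h1
  have hi1 := integrableOn_exp_mul (hG.integrableOn j) x
  have hi2 := integrableOn_exp_mul (hG.integrableOn_integral hα hT j) x
  have hi3 := integrableOn_exp_mul (hG.integrableOn_integral hα hT k) x
  have hj := (hi1.sub (hi2.const_mul (coef p b B j : ℂ))).const_mul (x + ρ * U j)
  have hk := (hi3.const_mul (coef p b B k : ℂ)).const_mul (x + ρ * U k)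
  have hFi : IntegrableOn F (Ioc 0 T) := hj.add hk
  have hFv : ∫ t in Ioc 0 T, F t = (x + ρ * U j) * ((∫ t in Ioc 0 T, e t * G j t) -
      coef p b B j * ∫ t in Ioc 0 T, e t * I j t) +
      (x + ρ * U k) * (coef p b B k * ∫ t in Ioc 0 T, e t * I k t) := by
    rw [← integral_const_mul (coef p b B j : ℂ), ← integral_const_mul (coef p b B k : ℂ),
      ← integral_sub hi1 (hi2.const_mul _), ← integral_const_mul, ← integral_const_mul]
    exact integral_add hj hk
  have h0 : Tendsto (fun t => e t * S t) (𝓝[>] 0) (𝓝 (G₀ j)) := by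
    have h1 : Tendsto e (𝓝[>] 0) (𝓝 (e 0)) := (hec.tendsto 0).mono_left nhdsWithin_le_nhds
    have h2 : Tendsto S (𝓝[>] 0) (𝓝 (G₀ j - coef p b B j * 0 + coef p b B k * 0)) :=
      ((hG.initial j).sub ((hG.tendsto_integral hα hT j).const_mul _)).add
        ((hG.tendsto_integral hα hT k).const_mul _)
    have h3 := h1.mul h2
    simpa [he] using h3
  have hTl : Tendsto (fun t => e t * S t) (𝓝[<] T) (𝓝 (e T * S T)) := by
    have hc : ContinuousOn S (Ioc 0 T) :=
      (((hG.differentiable j).continuousOn).sub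
        (continuousOn_const.mul (hG.differentiable_integral j).continuousOn)).add
        (continuousOn_const.mul (hG.differentiable_integral k).continuousOn)
    have h1 : Tendsto S (𝓝[<] T) (𝓝 (S T)) := by
      rw [← nhdsWithin_Ioo_eq_nhdsLT hT]
      exact (hc T ⟨hT, le_rfl⟩).mono Ioo_subset_Ioc_self
    exact ((hec.tendsto T).mono_left nhdsWithin_le_nhds).mul h1
  -- Only one-sided limits at the endpoints are available: nothing is assumed at `0`, and the
  -- derivative at `T` is one-sided.
  have hftc := intervalIntegral.integral_eq_sub_of_hasDerivAt_of_tendsto hT hd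
    ((intervalIntegrable_iff_integrableOn_Ioc_of_le hT.le).2 hFi.neg) h0 hTl
  rw [intervalIntegral.integral_neg, intervalIntegral.integral_of_le hT.le, hFv] at hftc
  linear_combination -hftc

/-- The fractional integral is a convolution, so `laplace_convolution` factors its transform; at `z
= x` the kernel contributes `(x + c) ^ (-α)`. -/
theorem IsSolution.laplace_integral (hG : IsSolution T p b α B U ρ G₀ G)
    (hα : ∀ j, 0 < α j ∧ α j < 1) (hT : 0 < T) {x₀ : ℝ} (hx₀ : 0 < x₀)
    (hU : ∀ j, 2 * ‖ρ * U j‖ ≤ x₀) (j : Fin 2) :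
    ∃ C, 0 ≤ C ∧ ∀ x, x₀ ≤ x → ∃ r : ℂ, ‖r‖ ≤ C * Real.exp (-(x * T)) ∧
      ∫ t in Ioc 0 T, ((Real.exp (-(x * t)) : ℝ) : ℂ) *
        substantialIntegral (α j) (ρ * U j) (G j) t =
      kernelSymbol (α j) (ρ * U j) (Real.log x) *
        (∫ t in Ioc 0 T, ((Real.exp (-(x * t)) : ℝ) : ℂ) * G j t) + r := by
  have hlt : ∀ x, x₀ ≤ x → ‖ρ * U j‖ < x := fun x hx => by
    linarith [hU j, norm_nonneg (ρ * (U j : ℂ))]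
  obtain ⟨C, hC⟩ := laplace_convolution hT (integrableOn_exp_mul_kernel (hα j).1 (hlt x₀ le_rfl))
    (hG.integrableOn j)
  have hC0 : 0 ≤ C := by
    have := (norm_nonneg _).trans (hC x₀ le_rfl)
    exact nonneg_of_mul_nonneg_left this (Real.exp_pos _)
  refine ⟨C, hC0, fun x hx => ⟨_, hC x hx, ?_⟩⟩
  rw [laplace_kernel (hα j).1 (hlt x hx), kernelSymbol_log (by linarith) ((hU j).trans hx)]
  simp only [substantialIntegral_eq]
  ring

/-- Cramer's rule applied to the two transformed equations with their errors. The factors `x + ρ U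
i` make the errors `O(x exp (-x T))`, but the division by `(x + ρ U j) D`, of modulus at least `x /
16`, removes the extra `x`. The constant is `32 = (3/2 + 1/2) * 16`. -/
theorem IsSolution.laplace_eq_solutionSymbol (hG : IsSolution T p b α B U ρ G₀ G)
    (hpb : p + b ≠ 1) (hα : ∀ j, 0 < α j ∧ α j < 1) (hT : 0 < T) {L : ℝ}
    (hc : ∀ j, 2 * ‖ρ * U j‖ ≤ Real.exp L)
    (ha : ∀ j, 4 * |coef p b B j| ≤ Real.exp (α j * L))
    (haa : 32 * |coef p b B 0 * coef p b B 1| ≤ Real.exp ((α 0 + α 1) * L))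
    {j k : Fin 2} (hjk : k ≠ j) :
    ∃ C, ∀ x, Real.exp L + 1 ≤ x →
      ‖(∫ t in Ioc 0 T, ((Real.exp (-(x * t)) : ℝ) : ℂ) * G j t) -
        solutionSymbol α (coef p b B) (fun i => ρ * U i) G₀ j k (Real.log x)‖ ≤
        C * Real.exp (-(x * T)) := by
  obtain ⟨Cj, hCj0, hCj⟩ := hG.laplace_integral hα hT (Real.exp_pos L) hc j
  obtain ⟨Ck, hCk0, hCk⟩ := hG.laplace_integral hα hT (Real.exp_pos L) hc k
  set a := coef p b B with ha_def
  set P := ‖flux p b α B U ρ G j k T‖ + ‖flux p b α B U ρ G k j T‖ with hP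
  set Q := 2 * (|a j| * Cj + |a k| * Ck) with hQ
  refine ⟨32 * (P + Q), fun x hx => ?_⟩
  have hxL : Real.exp L ≤ x := by linarith
  have hx1 : 1 ≤ x := by linarith [Real.exp_pos L]
  have hx0 : 0 < x := by linarith
  obtain ⟨rj, hrj, hJj⟩ := hCj x hxL
  obtain ⟨rk, hrk, hJk⟩ := hCk x hxL
  have h1 := hG.laplace_equation hpb hα hT hjk x
  have h2 := hG.laplace_equation hpb hα hT hjk.symm x
  rw [hJj, hJk] at h1 h2
  have hre : L ≤ ((Real.log x : ℝ) : ℂ).re := by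
    rw [Complex.ofReal_re]; exact (Real.le_log_iff_exp_le hx0).2 hxL
  have hexp : Complex.exp ((Real.log x : ℝ) : ℂ) = x := by
    rw [← Complex.ofReal_exp, Real.exp_log hx0]
  obtain ⟨hv, hD, -⟩ := symbol_bounds (c := fun i => ρ * U i) hα hc ha haa hre hjk
  have hwj := half_exp_le_norm (hc j) hre
  rw [hexp, Complex.ofReal_re, Real.exp_log hx0] at hwj
  have hw : ∀ i, ‖(x : ℂ) + ρ * U i‖ ≤ 2 * x := by
    intro i
    refine (norm_add_le _ _).trans ?_
    rw [Complex.norm_real, Real.norm_of_nonneg hx0.le]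
    linarith [hc i, norm_nonneg (ρ * (U i : ℂ))]
  rw [solutionSymbol, hexp]
  simp only [← ha_def] at h1 h2
  set Xj := ∫ t in Ioc 0 T, ((Real.exp (-(x * t)) : ℝ) : ℂ) * G j t
  set Xk := ∫ t in Ioc 0 T, ((Real.exp (-(x * t)) : ℝ) : ℂ) * G k t
  set yj := kernelSymbol (α j) (ρ * U j) (Real.log x)
  set yk := kernelSymbol (α k) (ρ * U k) (Real.log x)
  set wj := (x : ℂ) + ρ * U j
  set wk := (x : ℂ) + ρ * U k
  set E := Real.exp (-(x * T)) with hE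
  have hE0 : 0 < E := Real.exp_pos _
  set εj := wj * a j * rj - wk * a k * rk - E * flux p b α B U ρ G j k T with hεj
  set εk := wk * a k * rk - wj * a j * rj - E * flux p b α B U ρ G k j T with hεk
  have hwar : ∀ {w r : ℂ} {i : Fin 2} {C : ℝ}, ‖w‖ ≤ 2 * x → ‖r‖ ≤ C * E →
      ‖w * a i * r‖ ≤ 2 * x * |a i| * (C * E) := by
    intro w r i C hw hr
    rw [norm_mul, norm_mul, Complex.norm_real, Real.norm_eq_abs]
    gcongr
  have hEf : ∀ f : ℂ, ‖(E : ℂ) * f‖ = E * ‖f‖ := fun f => by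
    rw [norm_mul, Complex.norm_real, Real.norm_of_nonneg hE0.le]
  have hbj := hwar (i := j) (hw j) hrj
  have hbk := hwar (i := k) (hw k) hrk
  have hfj := norm_nonneg (flux p b α B U ρ G j k T)
  have hfk := norm_nonneg (flux p b α B U ρ G k j T)
  have hPx : P ≤ P * x := le_mul_of_one_le_right (by positivity) hx1
  have hεj_le : ‖εj‖ ≤ E * ((P + Q) * x) := by
    have h3 := (norm_sub_le (wj * a j * rj - wk * a k * rk)
      (E * flux p b α B U ρ G j k T)).trans (add_le_add_left (norm_sub_le _ _) _)
    rw [hEf] at h3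
    calc ‖εj‖ ≤ 2 * x * |a j| * (Cj * E) + 2 * x * |a k| * (Ck * E) + E * P := by
          have : E * ‖flux p b α B U ρ G j k T‖ ≤ E * P := by gcongr; linarith
          linarith
      _ = E * (P + Q * x) := by rw [hQ]; ring
      _ ≤ _ := by gcongr; linarith
  have hεk_le : ‖εk‖ ≤ E * ((P + Q) * x) := by
    have h3 := (norm_sub_le (wk * a k * rk - wj * a j * rj)
      (E * flux p b α B U ρ G k j T)).trans (add_le_add_left (norm_sub_le _ _) _)
    rw [hEf] at h3
    calc ‖εk‖ ≤ 2 * x * |a j| * (Cj * E) + 2 * x * |a k| * (Ck * E) + E * P := by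
          have : E * ‖flux p b α B U ρ G k j T‖ ≤ E * P := by gcongr; linarith
          linarith
      _ = E * (P + Q * x) := by rw [hQ]; ring
      _ ≤ _ := by gcongr; linarith
  set D := 1 - a j * yj - a k * yk with hDdef
  have hwD : 0 < ‖wj * D‖ := by
    rw [norm_mul]; exact mul_pos (by linarith) (by linarith)
  have hwD' : x / 16 ≤ ‖wj * D‖ := by
    rw [norm_mul]
    calc x / 16 = x / 2 * (1 / 8) := by ring
      _ ≤ _ := by gcongr
  have hsolve : Xj * (wj * D) = ((1 - a k * yk) * G₀ j - a k * yk * G₀ k) +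
      ((1 - a k * yk) * εj - a k * yk * εk) := by
    rw [hεj, hεk, hDdef]
    linear_combination (1 - a k * yk) * h1 - a k * yk * h2
  have hdiff : Xj - ((1 - a k * yk) * G₀ j - a k * yk * G₀ k) / (wj * D) =
      ((1 - a k * yk) * εj - a k * yk * εk) / (wj * D) := by
    have hne := norm_pos_iff.1 hwD
    rw [eq_div_iff hne, sub_mul, div_mul_cancel₀ _ hne, hsolve]
    ring
  rw [hdiff, norm_div, div_le_iff₀ hwD]
  have h1v : ‖1 - a k * yk‖ ≤ 3 / 2 := by
    refine (norm_sub_le _ _).trans ?_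
    rw [norm_one]; linarith
  calc ‖(1 - a k * yk) * εj - a k * yk * εk‖
      ≤ ‖1 - a k * yk‖ * ‖εj‖ + ‖a k * yk‖ * ‖εk‖ := by
        refine (norm_sub_le _ _).trans ?_
        rw [norm_mul, norm_mul (_ * _)]
    _ ≤ 3 / 2 * (E * ((P + Q) * x)) + 1 / 2 * (E * ((P + Q) * x)) := by gcongr
    _ = 32 * (P + Q) * E * (x / 16) := by ring
    _ ≤ _ := by gcongr

end solution

/-! ### Representation of the solution by a contour integral -/

theorem eq_zero_of_integral_eq_zero {T : ℝ} {f : ℝ → ℂ} (hf : IntegrableOn f (Ioc 0 T))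
    (hc : ContinuousOn f (Ioo 0 T)) (h : ∀ s ∈ Ioo 0 T, ∫ t in Ioc 0 s, f t = 0)
    {s : ℝ} (hs : s ∈ Ioo 0 T) : f s = 0 := by
  have hi : IntervalIntegrable f volume 0 s :=
    (intervalIntegrable_iff_integrableOn_Ioc_of_le hs.1.le).2
      (hf.mono_set (Ioc_subset_Ioc_right hs.2.le))
  have h1 := intervalIntegral.integral_hasDerivAt_right hi
    (hc.stronglyMeasurableAtFilter isOpen_Ioo s hs) (hc.continuousAt (isOpen_Ioo.mem_nhds hs))
  have h2 : HasDerivAt (fun u => ∫ t in (0 : ℝ)..u, f t) 0 s := by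
    refine (hasDerivAt_const s (0 : ℂ)).congr_of_eventuallyEq ?_
    filter_upwards [isOpen_Ioo.mem_nhds hs] with u hu
    rw [intervalIntegral.integral_of_le hu.1.le, h u hu]
  exact h1.unique h2

section solution

variable {T p b : ℝ} {α B U : Fin 2 → ℝ} {ρ : ℂ} {G₀ : Fin 2 → ℂ} {G : Fin 2 → ℝ → ℂ}

/-- A solution is represented by the inverse Laplace transform of its symbol. -/
theorem IsSolution.eqOn_inverseLaplace (hG : IsSolution T p b α B U ρ G₀ G)
    (hpb : p + b ≠ 1) (hα : ∀ j, 0 < α j ∧ α j < 1) (hT : 0 < T) {L θ K : ℝ}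
    (hθ : θ ∈ Ioo (Real.pi / 2) Real.pi)
    (hc : ∀ j, 2 * ‖ρ * U j‖ ≤ Real.exp L)
    (ha : ∀ j, 4 * |coef p b B j| ≤ Real.exp (α j * L))
    (haa : 32 * |coef p b B 0 * coef p b B 1| ≤ Real.exp ((α 0 + α 1) * L))
    {j k : Fin 2} (hjk : k ≠ j)
    (hK : ∀ ζ : ℂ, L ≤ ζ.re →
      ‖solutionSymbol α (coef p b B) (fun i => ρ * U i) G₀ j k ζ‖ ≤ K * Real.exp (-ζ.re)) :
    EqOn (G j) (inverseLaplace L θ (solutionSymbol α (coef p b B) (fun i => ρ * U i) G₀ j k))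
      (Ioc 0 T) := by
  set Φ := solutionSymbol α (coef p b B) (fun i => ρ * U i) G₀ j k with hΦ
  have hd : ∀ ζ : ℂ, L ≤ ζ.re → DifferentiableAt ℂ Φ ζ := fun ζ hζ =>
    differentiableAt_solutionSymbol hα hc ha haa hζ hjk
  set H := inverseLaplace L θ Φ with hH
  obtain ⟨hHi, C₁, hC₁⟩ := laplace_inverseLaplace hθ hT hd hK
  obtain ⟨C₂, hC₂⟩ := hG.laplace_eq_solutionSymbol hpb hα hT hc ha haa hjk
  have hGi := hG.integrableOn j
  have hHc : ∀ t, 0 < t → ContinuousAt H t := fun t ht =>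
    (hasDerivAt_inverseLaplace hθ ht hd hK).continuousAt
  have hGc : ContinuousOn (G j) (Ioc 0 T) := (hG.differentiable j).continuousOn
  obtain ⟨n₀, hn₀⟩ := exists_nat_ge (Real.exp L + 1)
  have hfi : IntegrableOn (fun t => G j t - H t) (Ioc 0 T) := hGi.sub hHi
  have hzero : ∀ s ∈ Ioo 0 T, ∫ t in Ioc 0 s, (G j t - H t) = 0 := by
    intro s hs
    refine integral_eq_zero_of_laplace_decay (C := C₁ + C₂) hfi n₀ (fun n hn => ?_) hs
    have hn' : Real.exp L + 1 ≤ n := hn₀.trans (by exact_mod_cast hn)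
    simp only [mul_sub]
    rw [integral_sub (integrableOn_exp_mul hGi n) (integrableOn_exp_mul hHi n), add_mul]
    have h1 := hC₁ n hn'
    have h2 := hC₂ n hn'
    rw [norm_sub_rev] at h1
    rw [← sub_add_sub_cancel _ (Φ (Real.log n)), add_comm]
    exact (norm_add_le _ _).trans (add_le_add h1 h2)
  have hEq : EqOn (G j) H (Ioo 0 T) := by
    intro s hs
    refine sub_eq_zero.1 (eq_zero_of_integral_eq_zero (f := fun t => G j t - H t) hfi
      ((hGc.mono Ioo_subset_Ioc_self).sub fun t ht => (hHc t ht.1).continuousWithinAt) hzero hs)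
  intro t ht
  -- Uniqueness yields only the open interval. The endpoint follows by left limits, and is needed
  -- for the one-sided derivative at `T`.
  rcases lt_or_eq_of_le ht.2 with h | h
  · exact hEq ⟨ht.1, h⟩
  · rw [h]
    have h1 : Tendsto (G j) (𝓝[<] T) (𝓝 (G j T)) := by
      rw [← nhdsWithin_Ioo_eq_nhdsLT hT]
      exact (hGc T ⟨hT, le_rfl⟩).mono Ioo_subset_Ioc_self
    have h2 : Tendsto H (𝓝[<] T) (𝓝 (H T)) := (hHc T hT).tendsto.mono_left nhdsWithin_le_nhds
    refine tendsto_nhds_unique h1 (h2.congr' ?_)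
    rw [← nhdsWithin_Ioo_eq_nhdsLT hT]
    filter_upwards [self_mem_nhdsWithin] with s hs
    exact (hEq hs).symm

end solution

theorem le_rpow_of_rpow_one_div_le {y δ γ : ℝ} (hy : 0 ≤ y) (hγ : 0 < γ)
    (h : y ^ (1 / γ) ≤ δ) : y ≤ δ ^ γ := by
  calc y = (y ^ (1 / γ)) ^ γ := by
        rw [← Real.rpow_mul hy, one_div_mul_cancel hγ.ne', Real.rpow_one]
    _ ≤ δ ^ γ := by gcongr

end FeynmanKac

end

/-! ### The final estimate -/

theorem theorem2p11
    (T p b : ℝ) (hp : p ∈ Set.Icc (0 : ℝ) 1) (hb : b ∈ Set.Icc (0 : ℝ) 1) (hpb : p + b ≠ 1)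
    (α B U : Fin 2 → ℝ) (hα : ∀ j, 0 < α j ∧ α j < 1) (hB : ∀ j, 0 < B j)
    (ρ : ℂ) (G₀ : Fin 2 → ℂ) (G : Fin 2 → ℝ → ℂ)
    (hG : FeynmanKac.IsSolution T p b α B U ρ G₀ G)
    (θ : ℝ) (hθ : θ ∈ Set.Ioo (Real.pi / 2) Real.pi)
    (δ : ℝ) (hδ : 0 < δ)
    (hδ_U : ∀ j, 2 * ‖ρ * (U j : ℂ)‖ ≤ δ)
    (hδ_m : ∀ j, (4 : ℝ) ^ (1 / α j) * |FeynmanKac.m p b j * (B j)⁻¹| ^ (1 / α j) ≤ δ)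
    (hδ_mm : (32 * |FeynmanKac.m p b 0 * FeynmanKac.m p b 1 * (B 0)⁻¹ * (B 1)⁻¹|)
      ^ (1 / (α 0 + α 1)) ≤ δ)
    (t : ℝ) (ht : 1 / δ < t) (htT : t ≤ T)
    (q : ℕ) (hq : q ≤ 1) (j k : Fin 2) (hjk : k ≠ j) :
    ‖iteratedDerivWithin q (G j) (Set.Ioc 0 T) t‖ ≤
      32 * |FeynmanKac.m p b k * (B k)⁻¹| / Real.pi *
          ((-1 / Real.cos θ) * t ^ (α k - q) * Real.exp (Real.cos θ)
            + 2 * θ * δ ^ (q - α k) * Real.exp (δ * T)) * ‖G₀ k‖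
        + 8 / Real.pi *
          ((-1 / Real.cos θ) * t ^ (-q : ℝ) * Real.exp (Real.cos θ)
            + 2 * θ * δ ^ (q : ℝ) * Real.exp (δ * T)) * ‖G₀ j‖ := by
  have ht0 : 0 < t := (one_div_pos.2 hδ).trans ht
  have hT : 0 < T := ht0.trans_le htT
  have hθ0 : 0 < θ := by linarith [hθ.1, Real.pi_pos]
  obtain ⟨L, rfl⟩ : ∃ L, Real.exp L = δ := ⟨Real.log δ, Real.exp_log hδ⟩
  set a := FeynmanKac.coef p b B with ha_def
  have ha : ∀ i, 4 * |a i| ≤ Real.exp (α i * L) := by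
    intro i
    have h := hδ_m i
    rw [← Real.mul_rpow (by norm_num) (abs_nonneg _)] at h
    rw [mul_comm (α i), Real.exp_mul]
    exact FeynmanKac.le_rpow_of_rpow_one_div_le (by positivity) (hα i).1 h
  have haa : 32 * |a 0 * a 1| ≤ Real.exp ((α 0 + α 1) * L) := by
    rw [mul_comm (α 0 + α 1), Real.exp_mul]
    refine FeynmanKac.le_rpow_of_rpow_one_div_le (by positivity)
      (add_pos (hα 0).1 (hα 1).1) ?_
    convert hδ_mm using 4
    simp only [ha_def, FeynmanKac.coef]
    ring
  set Φ := FeynmanKac.solutionSymbol α a (fun i => ρ * U i) G₀ j k with hΦ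
  have hd : ∀ ζ : ℂ, L ≤ ζ.re → DifferentiableAt ℂ Φ ζ := fun ζ hζ =>
    FeynmanKac.differentiableAt_solutionSymbol hα hδ_U ha haa hζ hjk
  have hbd : ∀ ζ : ℂ, L ≤ ζ.re → ‖Complex.exp ζ * Φ ζ‖ ≤
      32 * |a k| * ‖G₀ k‖ * Real.exp (-α k * ζ.re) + 8 * ‖G₀ j‖ := fun ζ hζ =>
    FeynmanKac.norm_exp_mul_solutionSymbol_le hα hδ_U ha haa hζ hjk
  -- A cruder bound, freezing `exp (-α k Re ζ)` at `Re ζ = L`. It serves only the representation;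
  -- the sharp `hbd` gives the estimate.
  have hK : ∀ ζ : ℂ, L ≤ ζ.re → ‖Φ ζ‖ ≤
      (32 * |a k| * ‖G₀ k‖ * Real.exp (-α k * L) + 8 * ‖G₀ j‖) * Real.exp (-ζ.re) := by
    intro ζ hζ
    have h1 := hbd ζ hζ
    rw [norm_mul, Complex.norm_exp] at h1
    rw [Real.exp_neg, ← div_eq_mul_inv, le_div_iff₀ (Real.exp_pos _), mul_comm]
    refine h1.trans ?_
    gcongr ?_ * Real.exp ?_ + _
    nlinarith [(hα k).1]
  have hEq := hG.eqOn_inverseLaplace hpb hα hT hθ hδ_U ha haa hjk hK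
  have htmem : t ∈ Set.Ioc 0 T := ⟨ht0, htT⟩
  have htL : Real.exp (-L) < t := by rwa [Real.exp_neg, ← one_div]
  have hrep : ‖iteratedDerivWithin q (G j) (Set.Ioc 0 T) t‖ =
      ‖FeynmanKac.inverseLaplace L θ (fun ζ => Complex.exp ζ ^ q * Φ ζ) t‖ := by
    interval_cases q
    · simp only [iteratedDerivWithin_zero, pow_zero, one_mul]
      rw [hEq htmem]
    · simp only [pow_one]
      rw [iteratedDerivWithin_one, derivWithin_congr hEq (hEq htmem),
        (FeynmanKac.hasDerivAt_inverseLaplace hθ ht0 hd hK).hasDerivWithinAt.derivWithin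
          (uniqueDiffOn_Ioc 0 T t htmem)]
  have hq1 : (q : ℝ) ≤ 1 := by exact_mod_cast hq
  have hfin := FeynmanKac.norm_inverseLaplace_le (L := L) (T := T)
    (A₁ := 32 * |a k| * ‖G₀ k‖) (A₂ := 8 * ‖G₀ j‖) (β₁ := q - α k) (β₂ := q)
    (Φ := fun ζ => Complex.exp ζ ^ q * Φ ζ) hθ htL htT (by linarith [(hα k).1]) hq1
    (by positivity) (by positivity) (fun ζ hζ => by
      rw [mul_left_comm, norm_mul, norm_pow, Complex.norm_exp, ← Real.exp_nat_mul]
      refine (mul_le_mul_of_nonneg_left (hbd ζ hζ) (Real.exp_pos _).le).trans (le_of_eq ?_)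
      rw [sub_mul, sub_eq_add_neg, Real.exp_add, neg_mul]
      ring)
  rw [hrep]
  refine hfin.trans ?_
  rw [neg_sub, mul_comm ((q : ℝ) - α k) L, Real.exp_mul L, mul_comm (q : ℝ) L, Real.exp_mul L]
  have hcos := FeynmanKac.cos_neg_of_mem hθ
  have hpi := Real.pi_pos
  -- The arc estimate produces `θ`; the stated `2 * θ` is weaker by a factor of two.
  have hle : ∀ R S : ℝ, 0 ≤ S → R + θ * S * Real.exp (Real.exp L * T) ≤
      R + 2 * θ * S * Real.exp (Real.exp L * T) := by
    intro R S hS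
    gcongr
    linarith
  refine add_le_add ?_ ?_
  · refine (mul_le_mul_of_nonneg_left (hle _ _ (by positivity)) (by positivity)).trans
      (le_of_eq ?_)
    simp only [ha_def, FeynmanKac.coef]
    ring
  · refine (mul_le_mul_of_nonneg_left (hle _ _ (by positivity)) (by positivity)).trans
      (le_of_eq ?_)
    ring
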